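/- \textbf{Theorem (Non-alternating service system).} Let $n\ge 1$, $\mu>0$, and let $A\ge 0$ be a random variable with Laplace transform $\alpha(s)=\mathbb E[e^{-sA}]$. A single server serves two service points. A customer at a service point first undergoes a preparation, consisting of $n$ consecutive independent phases, each exponential with parameter $\mu$; so the preparation time $B$ is Erlang-$n$ distributed. As soon as a service is completed, a new customer starts its preparation at the service point just emptied. The server then serves whichever of the two customers completes its preparation first; each service time is distributed as $A$, and all phases and service times are independent. Immediately after the $m$-th service completion ($m=0,1,2,\dots$), let $N_m\in\{0,\dots,n\}$ and $R_m$ be the number of remaining preparation phases and the remaining preparation time of the customer at the other service point, let $B_{m+1}$ be the preparation time of the new customer, and let $W_m=\min\{B_{m+1},R_m\}$ be the waiting time of the server. The initial number $N_0$ has an arbitrary distribution on $\{0,\dots,n\}$; given $N_0$, the remaining phases are independent and exponential with parameter $\mu$, and all this is independent of the later preparation and service times. Then $(N_m)$ is a Markov chain on $\{0,\dots,n\}$ with one-step transition probabilities, for $i,j\in\{1,\dots,n\}$, \begin{align} p_{ij}&=\sum_{k=j}^n \Big(\tfrac12\Big)^{n+i-k}\Big[\tbinom{n+i-k-1}{n-1}+\tbinom{n+i-k-1}{n-k}\Big]\frac{(-\mu)^{k-j}}{(k-j)!}\,\alpha^{(k-j)}(\mu),\tag{1}\\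 p_{0j}&=\frac{(-\mu)^{n-j}}{(n-j)!}\,\alpha^{(n-j)}(\mu),\tag{2}\\ p_{00}&=\sum_{l=n}^\infty \frac{(-\mu)^{l}}{l!}\,\alpha^{(l)}(\mu),\tag{3}\\ p_{i0}&=\sum_{k=1}^n \Big(\tfrac12\Big)^{n+i-k}\Big[\tbinom{n+i-k-1}{n-1}+\tbinom{n+i-k-1}{n-k}\Big]\sum_{l=k}^\infty \frac{(-\mu)^{l}}{l!}\,\alpha^{(l)}(\mu),\tag{4} \end{align} where $\binom ab=0$ for $0\le a<b$ and the infinite series converge. The system of equations $$\pi_i=\sum_{k=0}^n\pi_k\,p_{ki}\quad(i=0,\dots,n),\qquad \sum_{k=0}^n\pi_k=1$$ has a unique real solution $(\pi_0,\dots,\pi_n)$, and $\pi_i\ge 0$ for all $i$. Let $E_i(x)=1-e^{-\mu x}\sum_{j=0}^{i-1}(\mu x)^j/j!$ for $x\ge 0$ and $E_i(x)=0$ for $x<0$. Then $F_B=E_n$ is the distribution function of the preparation times. In steady state the remaining preparation time has the distribution function $$F_R(x)=\pi_0+\pi_1E_1(x)+\dots+\pi_nE_n(x)\ \ (x\ge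 0),\qquad F_R(x)=0\ \ (x<0),$$ and the waiting time of the server has the distribution function $$F_W(x)=F_R(x)+F_B(x)-F_R(x)F_B(x).$$ Here ``in steady state'' means both of the following. For every distribution of $N_0$, as $m\to\infty$, $\mathbb P[N_m=i]\to\pi_i$ for all $i$, and $\mathbb P[R_m\le x]\to F_R(x)$ and $\mathbb P[W_m\le x]\to F_W(x)$ for every real $x$. If $N_0$ has distribution $\pi$, then for every $m$, $N_m$ has distribution $\pi$, $R_m$ has distribution function $F_R$ and $W_m$ has distribution function $F_W$. -/

import Mathlib

open MeasureTheory ProbabilityTheory Filter Topology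

namespace MachineRepair

noncomputable section

/-! ### Sample-path description of the system -/

/-- `elapse l t`: the residual durations of the unfinished phases of a preparation, `t` time units
after its unfinished phases, to be completed one after the other, had the durations listed
in `l`. -/
def elapse : List ℝ → ℝ → List ℝ
  | [], _ => []
  | d :: l, t => if t < d then (d - t) :: l else elapse l (t - d)

section Paths

variable {Ω : Type*} {n : ℕ}
  (K : Ω → Fin (n + 1)) (X : ℕ → Fin n → Ω → ℝ) (A : ℕ → Ω → ℝ)

/-- Preparation time of customer `c`: the sum of its `n` phases. -/
def prep (c : ℕ) (ω : Ω) : ℝ := ∑ l, X c l ω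

/-- Residual durations of the unfinished phases of the *other* customer (the one that was not
served), immediately after the `m`-th service completion. Initially there are `K` of them.
Immediately after the `m`-th service completion, customer `m + 1` starts its preparation at the
service point that has just been emptied. The server takes the customer whose preparation is
completed first and serves it for a time `A m`; meanwhile the preparation of the remaining
customer goes on, and this customer is the other one at the next service completion. -/
def residual : ℕ → Ω → List ℝ
  | 0, ω => (List.ofFn fun l => X 0 l ω).take (K ω)
  | m + 1, ω =>
      let z := residual m ω
      let x := List.ofFn fun l => X (m + 1) l ω
      if x.sum ≤ z.sum then elapse z (x.sum + A m ω) else elapse x (z.sum + A m ω)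

/-- Number of remaining preparation phases of the other customer, immediately after the `m`-th
service completion. -/
def phases (m : ℕ) (ω : Ω) : ℕ := (residual K X A m ω).length

/-- Remaining preparation time `R` of the other customer, immediately after the `m`-th service
completion. -/
def remaining (m : ℕ) (ω : Ω) : ℝ := (residual K X A m ω).sum

/-- Waiting time `W = min {B, R}` of the server after the `m`-th service completion. -/
def waiting (m : ℕ) (ω : Ω) : ℝ := min (prep X (m + 1) ω) (remaining K X A m ω)

/-- The probabilistic assumptions: all phases are exponential with parameter `μ`, all service times
have law `ν`, all of these are mutually independent, and the initial number `K` of remaining phases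
(of arbitrary law) is independent of them. -/
structure IsModel [MeasurableSpace Ω] (P : Measure Ω) (μ : ℝ) (ν : Measure ℝ) : Prop where
  measurable_init : Measurable K
  measurable_phase : ∀ c l, Measurable (X c l)
  measurable_service : ∀ m, Measurable (A m)
  law_phase : ∀ c l, P.map (X c l) = expMeasure μ
  law_service : ∀ m, P.map (A m) = ν
  indep : iIndepFun (Sum.elim (fun p : ℕ × Fin n => X p.1 p.2) A) P
  indep_init :
    IndepFun K (fun ω k => Sum.elim (fun p : ℕ × Fin n => X p.1 p.2) A k ω) P

end Paths

/-! ### The explicit formulas -/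

/-- Laplace transform of the law `ν` of the service times. -/
def laplace (ν : Measure ℝ) (s : ℝ) : ℝ := ∫ t, Real.exp (-(s * t)) ∂ν

/-- `(-μ)^m / m! * α^(m)(μ)`, with `α` the Laplace transform of the service time. -/
def serviceTerm (μ : ℝ) (ν : Measure ℝ) (m : ℕ) : ℝ :=
  (-μ) ^ m / (m.factorial : ℝ) * iteratedDeriv m (laplace ν) μ

/-- `(1/2)^(n+i-k) [C(n+i-k-1, n-1) + C(n+i-k-1, n-k)]`, used for `1 ≤ i` and `1 ≤ k ≤ n`. -/
def raceTerm (n i k : ℕ) : ℝ :=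
  (1 / 2 : ℝ) ^ (n + i - k) *
    (((n + i - k - 1).choose (n - 1) : ℝ) + ((n + i - k - 1).choose (n - k) : ℝ))

/-- The matrix `p i j`, for `0 ≤ i, j ≤ n`. -/
def transProb (n : ℕ) (μ : ℝ) (ν : Measure ℝ) (i j : ℕ) : ℝ :=
  if i = 0 then
    if j = 0 then ∑' m : ℕ, serviceTerm μ ν (n + m)
    else serviceTerm μ ν (n - j)
  else
    if j = 0 then ∑ k ∈ Finset.Icc 1 n, raceTerm n i k * ∑' m : ℕ, serviceTerm μ ν (k + m)
    else ∑ k ∈ Finset.Icc j n, raceTerm n i k * serviceTerm μ ν (k - j)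

/-- The equilibrium equations together with the normalising equation. -/
def IsEquilibrium (n : ℕ) (μ : ℝ) (ν : Measure ℝ) (w : Fin (n + 1) → ℝ) : Prop :=
  (∀ i, w i = ∑ k, w k * transProb n μ ν k i) ∧ ∑ k, w k = 1

/-- Distribution function `E_i` of the Erlang-`i` distribution with parameter `μ` (`i ≥ 1`). -/
def erlangCDF (μ : ℝ) (i : ℕ) (x : ℝ) : ℝ :=
  if x < 0 then 0
  else 1 - Real.exp (-(μ * x)) * ∑ j ∈ Finset.range i, (μ * x) ^ j / (j.factorial : ℝ)

/-- The mixed Erlang distribution function `π₀ + π₁ E₁(x) + ⋯ + πₙ Eₙ(x)` on `[0, ∞)`. -/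
def mixedErlangCDF {n : ℕ} (μ : ℝ) (w : Fin (n + 1) → ℝ) (x : ℝ) : ℝ :=
  if x < 0 then 0 else w 0 + ∑ i : Fin n, w i.succ * erlangCDF μ (i + 1) x

end

end MachineRepair

open MachineRepair

/-!
The proof rests on the memorylessness of the exponential law. Write `phaseLaw μ k` for the law of a
list of `k` independent phases, exponential with parameter `μ`.

* If the phases of such a list run for a fixed time `t`, then they run off like a Poisson process
  (`lintegral_elapse`): conditionally on their number, the residual phases are again independent and
  exponential. Averaging over the service time turns the Poisson probabilities into the
  terms `(-μ)^m / m! * α^(m)(μ)` (`serviceTerm_eq_integral`), because `α^(m)(μ)` is the integral of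
  `(-t)^m e^{-μt}`. Since the sum of a list of positive durations is at most `t` iff nothing is left
  after time `t`, the same lemma gives the Erlang distribution function (`measure_sum_le_phaseLaw`).
* In the race between two such lists, each phase completion belongs to either list with probability
  `1/2`, and what is left of the other current phase is again exponential (`lintegral_race`).
  Hence the law of what is left of the loser is a mixture of the laws `phaseLaw μ k`, with weights
  that satisfy the recursion of a fair random walk (`lintegral_leftover`); Pascal's rule solves it
  (`raceProb_eq_raceTerm`).

Together these facts say that one step of the system turns a mixture of the laws `phaseLaw μ i` into
a mixture of the same form, with the weights multiplied by the matrix `transProb` (`map_step_sum`).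
As the phases of the new customer and the service time are independent of the past
(`IsModel.indep_past`), it follows by induction that, given the numbers of remaining phases so far,
the residual phases have law `phaseLaw μ k`, with `k` the current number
(`IsModel.map_residual_history`). This is the Markov property, and it gives the distribution
functions of `R` and `W`.

The column of `transProb` that belongs to the state `n` is bounded below by a positive constant, so
the matrix is a strict `ℓ¹`-contraction on vectors with sum zero (`sum_abs_vecMul_le`). This yields
the uniqueness of the equilibrium and the convergence to it from any initial distribution; existence
is linear algebra, as `1` is an eigenvalue of every stochastic matrix.
-/

open scoped ENNReal

namespace MachineRepair

/-! ### Measurability on lists of real numbers -/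

/-- The σ-algebra on finite lists of reals generated by the length and the entries (the entries
past the end of the list being read as `0`). -/
instance listMeasurableSpace : MeasurableSpace (List ℝ) :=
  MeasurableSpace.comap (fun l => (l.length, fun i : ℕ => l.getD i 0)) inferInstance

lemma measurable_length_getD :
    Measurable (fun l : List ℝ => (l.length, fun i : ℕ => l.getD i 0)) :=
  comap_measurable _

lemma measurable_length : Measurable (List.length : List ℝ → ℕ) :=
  measurable_fst.comp measurable_length_getD

lemma measurable_getD (i : ℕ) : Measurable (fun l : List ℝ => l.getD i 0) :=
  (measurable_pi_apply i).comp (measurable_snd.comp measurable_length_getD)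

lemma measurable_list {α : Type*} [MeasurableSpace α] {f : α → List ℝ}
    (h₁ : Measurable fun a => (f a).length) (h₂ : ∀ i, Measurable fun a => (f a).getD i 0) :
    Measurable f :=
  measurable_comap_iff.2 (h₁.prodMk (measurable_pi_lambda _ h₂))

@[fun_prop]
lemma Measurable.list_cons {α : Type*} [MeasurableSpace α] {f : α → ℝ} {g : α → List ℝ}
    (hf : Measurable f) (hg : Measurable g) : Measurable fun a => f a :: g a := by
  refine measurable_list ?_ fun i => ?_
  · simpa using (measurable_length.comp hg).add_const 1
  · cases i with
    | zero => simpa using hf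
    | succ i => simpa [Function.comp_def] using (measurable_getD i).comp hg

@[fun_prop]
lemma measurable_ofFn {k : ℕ} : Measurable (List.ofFn : (Fin k → ℝ) → List ℝ) := by
  refine measurable_list (by simp) fun i => ?_
  by_cases h : i < k
  · simpa [List.getD_eq_getElem?_getD, List.getElem?_ofFn, h] using
      measurable_pi_apply (X := fun _ : Fin k => ℝ) ⟨i, h⟩
  · simp [List.getD_eq_getElem?_getD, h]

/-- A function of a list (and a parameter) is measurable as soon as it is measurable on the lists
of each fixed length. -/
lemma measurable_of_ofFn {β γ : Type*} [MeasurableSpace β] [MeasurableSpace γ]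
    {f : List ℝ × β → γ}
    (h : ∀ k, Measurable fun p : (Fin k → ℝ) × β => f (List.ofFn p.1, p.2)) : Measurable f := by
  intro S hS
  have key : f ⁻¹' S = ⋃ k : ℕ, {p : List ℝ × β | p.1.length = k} ∩
      (fun p : List ℝ × β => ((fun i : Fin k => p.1.getD i 0), p.2)) ⁻¹'
        ((fun p : (Fin k → ℝ) × β => f (List.ofFn p.1, p.2)) ⁻¹' S) := by
    ext ⟨l, b⟩
    have hl : List.ofFn (fun i : Fin l.length => l.getD i 0) = l := by
      apply List.ext_getElem <;> simp
    simp only [Set.mem_preimage, Set.mem_iUnion, Set.mem_inter_iff, Set.mem_ofPred_eq]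
    constructor
    · intro hb
      exact ⟨l.length, rfl, by rwa [hl]⟩
    · rintro ⟨k, rfl, hb⟩
      rwa [hl] at hb
  rw [key]
  refine MeasurableSet.iUnion fun k => ((measurable_length.comp measurable_fst)
    (measurableSet_singleton k)).inter (Measurable.prodMk ?_ measurable_snd (h k hS))
  exact measurable_pi_lambda _ fun i => (measurable_getD i).comp measurable_fst

lemma measurable_of_ofFn' {γ : Type*} [MeasurableSpace γ] {f : List ℝ → γ}
    (h : ∀ k, Measurable fun y : Fin k → ℝ => f (List.ofFn y)) : Measurable f := by
  have : Measurable fun p : List ℝ × Unit => f p.1 :=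
    measurable_of_ofFn fun k => (h k).comp measurable_fst
  exact this.comp (g := fun p : List ℝ × Unit => f p.1) (f := fun l => (l, ()))
    (measurable_id.prodMk measurable_const)

lemma measurable_sum_list : Measurable (List.sum : List ℝ → ℝ) := by
  refine measurable_of_ofFn' fun k => ?_
  simp only [List.sum_ofFn]
  fun_prop

@[fun_prop]
lemma Measurable.list_sum {α : Type*} [MeasurableSpace α] {g : α → List ℝ}
    (hg : Measurable g) : Measurable fun a => (g a).sum :=
  measurable_sum_list.comp hg

lemma measurable_take (k : ℕ) : Measurable (List.take k : List ℝ → List ℝ) := by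
  refine measurable_list ?_ fun i => ?_
  · simp only [List.length_take]
    exact measurable_const.min measurable_length
  · by_cases h : i < k
    · simpa [List.getD_eq_getElem?_getD, List.getElem?_take, h] using measurable_getD i
    · simp [List.getD_eq_getElem?_getD, h]

lemma measurable_elapse : Measurable fun p : List ℝ × ℝ => elapse p.1 p.2 := by
  refine measurable_of_ofFn fun k => ?_
  induction k with
  | zero => simp [elapse]
  | succ k ih =>
    simp only [List.ofFn_succ, elapse]
    refine Measurable.ite (measurableSet_lt measurable_snd (by fun_prop)) (by fun_prop) ?_
    exact ih.comp
      (f := fun p : (Fin (k + 1) → ℝ) × ℝ => ((fun i : Fin k => p.1 i.succ), p.2 - p.1 0))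
      (by fun_prop)

@[fun_prop]
lemma Measurable.elapse {α : Type*} [MeasurableSpace α] {f : α → ℝ} {g : α → List ℝ}
    (hg : Measurable g) (hf : Measurable f) : Measurable fun a => elapse (g a) (f a) :=
  measurable_elapse.comp (hg.prodMk hf)

/-! ### The exponential law -/

section Exponential

variable {μ : ℝ}

lemma lintegral_expMeasure (G : ℝ → ℝ≥0∞) (hG : Measurable G) :
    ∫⁻ d, G d ∂expMeasure μ = ∫⁻ d, exponentialPDF μ d * G d := by
  have : Measurable (exponentialPDF μ) := (measurable_exponentialPDFReal μ).ennreal_ofReal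
  exact lintegral_withDensity_eq_lintegral_mul _ this hG

instance : NullSingletonClass (expMeasure μ) := by
  unfold expMeasure gammaMeasure
  exact nullSingletonClass_withDensity _

/-- The Poisson probability `e^{-μt} (μt)^m / m!`. -/
noncomputable def poissonWeight (μ : ℝ) (m : ℕ) (t : ℝ) : ℝ :=
  Real.exp (-(μ * t)) * (μ * t) ^ m / (m.factorial : ℝ)

@[fun_prop]
lemma measurable_poissonWeight (m : ℕ) : Measurable (poissonWeight μ m) := by
  unfold poissonWeight; fun_prop

lemma hasSum_poissonWeight (t : ℝ) : HasSum (fun m => poissonWeight μ m t) 1 := by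
  have h := (NormedSpace.expSeries_div_hasSum_exp (μ * t)).mul_left (Real.exp (-(μ * t)))
  rw [← Real.exp_eq_exp_ℝ, ← Real.exp_add] at h
  simpa [poissonWeight, mul_div_assoc] using h

lemma ae_pos_expMeasure : ∀ᵐ d ∂expMeasure μ, 0 < d := by
  have h : expMeasure μ (Set.Iic 0) = 0 := by
    rw [← lintegral_indicator_one measurableSet_Iic,
      lintegral_expMeasure _ (measurable_one.indicator measurableSet_Iic),
      ← lintegral_zero (α := ℝ) (μ := volume)]
    refine lintegral_congr_ae ?_
    filter_upwards [Measure.ae_ne volume (0 : ℝ)] with d hd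
    rcases lt_or_gt_of_ne hd with h | h
    · simp [exponentialPDF_of_neg h]
    · simp [h]
  filter_upwards [measure_eq_zero_iff_ae_notMem.1 h] with d hd
  simpa using hd

/-- Memorylessness of the exponential law. -/
lemma lintegral_overshoot_le {t : ℝ} (ht : 0 ≤ t) {G : ℝ → ℝ≥0∞} (hG : Measurable G) :
    ∫⁻ d, (if t ≤ d then G (d - t) else 0) ∂expMeasure μ
      = ENNReal.ofReal (Real.exp (-(μ * t))) * ∫⁻ d, G d ∂expMeasure μ := by
  have hm : Measurable (exponentialPDF μ) := (measurable_exponentialPDFReal μ).ennreal_ofReal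
  have hle : Measurable fun d : ℝ => if t ≤ d then G (d - t) else 0 :=
    Measurable.ite measurableSet_Ici (by fun_prop) measurable_const
  rw [lintegral_expMeasure _ hle, lintegral_expMeasure _ hG,
    ← lintegral_sub_right_eq_self (fun d => exponentialPDF μ d * G d) t,
    ← lintegral_const_mul _ (by fun_prop)]
  refine lintegral_congr fun d => ?_
  split_ifs with h
  · rw [exponentialPDF_of_nonneg (ht.trans h), exponentialPDF_of_nonneg (sub_nonneg.2 h),
      ← mul_assoc, ← ENNReal.ofReal_mul (Real.exp_nonneg _)]
    congr 2
    rw [mul_left_comm, ← Real.exp_add]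
    ring_nf
  · rw [exponentialPDF_of_neg (sub_neg.2 (not_le.1 h))]
    simp

lemma lintegral_overshoot_lt {t : ℝ} (ht : 0 ≤ t) {G : ℝ → ℝ≥0∞} (hG : Measurable G) :
    ∫⁻ d, (if t < d then G (d - t) else 0) ∂expMeasure μ
      = ENNReal.ofReal (Real.exp (-(μ * t))) * ∫⁻ d, G d ∂expMeasure μ := by
  rw [← lintegral_overshoot_le ht hG]
  refine lintegral_congr_ae ?_
  filter_upwards [Measure.ae_ne (expMeasure μ) t] with d hd
  simp only [le_iff_lt_or_eq, hd.symm, or_false]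

variable [hμ : Fact (0 < μ)]

instance : IsProbabilityMeasure (expMeasure μ) := isProbabilityMeasure_expMeasure hμ.out

lemma poissonWeight_nonneg (m : ℕ) {t : ℝ} (ht : 0 ≤ t) : 0 ≤ poissonWeight μ m t := by
  have := hμ.out
  unfold poissonWeight
  positivity

lemma lintegral_exp_expMeasure :
    ∫⁻ d, ENNReal.ofReal (Real.exp (-(μ * d))) ∂expMeasure μ = 2⁻¹ := by
  have hμ0 := hμ.out
  have h2 : (0 : ℝ) < 2 * μ := by positivity
  have hm : Measurable (exponentialPDF (2 * μ)) :=
    (measurable_exponentialPDFReal (2 * μ)).ennreal_ofReal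
  rw [lintegral_expMeasure _ (by fun_prop)]
  have : ∀ d, exponentialPDF μ d * ENNReal.ofReal (Real.exp (-(μ * d)))
      = 2⁻¹ * exponentialPDF (2 * μ) d := by
    intro d
    rcases lt_or_ge d 0 with h | h
    · simp [exponentialPDF_of_neg h]
    · have h' : (2⁻¹ : ℝ≥0∞) = ENNReal.ofReal 2⁻¹ := by
        rw [ENNReal.ofReal_inv_of_pos two_pos]; simp
      rw [exponentialPDF_of_nonneg h, exponentialPDF_of_nonneg h, h',
        ← ENNReal.ofReal_mul (by positivity), ← ENNReal.ofReal_mul (by positivity)]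
      congr 1
      rw [mul_assoc, ← Real.exp_add]
      ring_nf
  simp_rw [this]
  rw [lintegral_const_mul _ hm,
    lintegral_exponentialPDF_eq_one h2, mul_one]

/-- Of two independent exponential phases each finishes first with probability `1/2`, and what
remains of the other one is again exponential. -/
lemma lintegral_race {G₁ G₂ : ℝ → ℝ≥0∞} (h₁ : Measurable G₁) (h₂ : Measurable G₂) :
    ∫⁻ d, ∫⁻ e, (if d < e then G₁ (e - d) else G₂ (d - e)) ∂expMeasure μ ∂expMeasure μ
      = 2⁻¹ * ∫⁻ u, G₁ u ∂expMeasure μ + 2⁻¹ * ∫⁻ u, G₂ u ∂expMeasure μ := by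
  have m₁ : Measurable fun p : ℝ × ℝ => if p.1 < p.2 then G₁ (p.2 - p.1) else 0 :=
    Measurable.ite (measurableSet_lt measurable_fst measurable_snd) (by fun_prop) measurable_const
  have m₂ : Measurable fun p : ℝ × ℝ => if p.2 ≤ p.1 then G₂ (p.1 - p.2) else 0 :=
    Measurable.ite (measurableSet_le measurable_snd measurable_fst) (by fun_prop) measurable_const
  have split : ∀ d e : ℝ, (if d < e then G₁ (e - d) else G₂ (d - e))
      = (if d < e then G₁ (e - d) else 0) + (if e ≤ d then G₂ (d - e) else 0) := by
    intro d e
    by_cases h : d < e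
    · simp [h, not_le.2 h]
    · simp [h, not_lt.1 h]
  simp_rw [split]
  have e₁ : ∀ d, ∫⁻ e, ((if d < e then G₁ (e - d) else 0) + (if e ≤ d then G₂ (d - e) else 0))
      ∂expMeasure μ = ∫⁻ e, (if d < e then G₁ (e - d) else 0) ∂expMeasure μ
        + ∫⁻ e, (if e ≤ d then G₂ (d - e) else 0) ∂expMeasure μ := fun d =>
    lintegral_add_left (m₁.comp (measurable_const.prodMk measurable_id)) _
  simp_rw [e₁]
  rw [lintegral_add_left m₁.lintegral_prod_right',
    lintegral_lintegral_swap (f := fun d e => if e ≤ d then G₂ (d - e) else 0) m₂.aemeasurable]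
  have q₁ : ∫⁻ d, ∫⁻ e, (if d < e then G₁ (e - d) else 0) ∂expMeasure μ ∂expMeasure μ
      = 2⁻¹ * ∫⁻ u, G₁ u ∂expMeasure μ := by
    rw [← lintegral_exp_expMeasure (μ := μ), ← lintegral_mul_const _ (by fun_prop)]
    refine lintegral_congr_ae ?_
    filter_upwards [ae_pos_expMeasure] with d hd
    exact lintegral_overshoot_lt hd.le h₁
  have q₂ : ∫⁻ e, ∫⁻ d, (if e ≤ d then G₂ (d - e) else 0) ∂expMeasure μ ∂expMeasure μ
      = 2⁻¹ * ∫⁻ u, G₂ u ∂expMeasure μ := by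
    rw [← lintegral_exp_expMeasure (μ := μ), ← lintegral_mul_const _ (by fun_prop)]
    refine lintegral_congr_ae ?_
    filter_upwards [ae_pos_expMeasure] with d hd
    exact lintegral_overshoot_le hd.le h₂
  rw [q₁, q₂]

/-- Convolution step of the Poisson process: the first event happens at an exponential time `d`,
and `m` further events follow up to time `t`. -/
lemma lintegral_poissonWeight_sub (m : ℕ) {t : ℝ} (ht : 0 ≤ t) :
    ∫⁻ d, (if t < d then 0 else ENNReal.ofReal (poissonWeight μ m (t - d))) ∂expMeasure μ
      = ENNReal.ofReal (poissonWeight μ (m + 1) t) := by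
  have hμ0 := hμ.out
  have hle : Measurable fun d : ℝ => if t < d then (0 : ℝ≥0∞)
      else ENNReal.ofReal (poissonWeight μ m (t - d)) :=
    Measurable.ite measurableSet_Ioi measurable_const (by fun_prop)
  rw [lintegral_expMeasure _ hle]
  have hF : ∀ d, exponentialPDF μ d * (if t < d then (0 : ℝ≥0∞)
      else ENNReal.ofReal (poissonWeight μ m (t - d)))
      = (Set.Icc 0 t).indicator (fun d => ENNReal.ofReal
        (μ ^ (m + 1) * Real.exp (-(μ * t)) / (m.factorial : ℝ) * (t - d) ^ m)) d := by
    intro d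
    by_cases h0 : d < 0
    · rw [exponentialPDF_of_neg h0, Set.indicator_of_notMem (by simp [h0]), zero_mul]
    by_cases h1 : t < d
    · rw [if_pos h1, Set.indicator_of_notMem (by simp [h1]), mul_zero]
    rw [if_neg h1, Set.indicator_of_mem (by simpa using ⟨not_lt.1 h0, not_lt.1 h1⟩),
      exponentialPDF_of_nonneg (not_lt.1 h0), ← ENNReal.ofReal_mul (by positivity)]
    congr 1
    rw [poissonWeight, mul_pow]
    have : Real.exp (-(μ * t)) = Real.exp (-(μ * d)) * Real.exp (-(μ * (t - d))) := by
      rw [← Real.exp_add]; ring_nf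
    rw [this]
    ring
  simp_rw [hF]
  rw [lintegral_indicator measurableSet_Icc, ← ofReal_integral_eq_lintegral_ofReal]
  · congr 1
    rw [integral_Icc_eq_integral_Ioc, ← intervalIntegral.integral_of_le ht,
      intervalIntegral.integral_const_mul,
      intervalIntegral.integral_comp_sub_left (fun x => x ^ m) t, integral_pow, poissonWeight,
      Nat.factorial_succ]
    push_cast
    have : (m : ℝ) + 1 ≠ 0 := by positivity
    have h' : (m.factorial : ℝ) ≠ 0 := by positivity
    simp
    field_simp
    rw [mul_pow]
  · exact (Continuous.integrableOn_Icc (by fun_prop))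
  · refine (ae_restrict_iff' measurableSet_Icc).2 (ae_of_all _ fun d hd => ?_)
    have := sub_nonneg.2 hd.2
    simp only [Pi.zero_apply]
    positivity

end Exponential

/-! ### Elapsing time -/

lemma elapse_zero {l : List ℝ} (hl : ∀ d ∈ l, 0 < d) : elapse l 0 = l := by
  cases l with
  | nil => rfl
  | cons d l => simp [elapse, hl d (by simp)]

lemma elapse_elapse (l : List ℝ) (s : ℝ) {t : ℝ} (ht : 0 ≤ t) :
    elapse (elapse l s) t = elapse l (s + t) := by
  induction l generalizing s with
  | nil => rfl
  | cons d l ih =>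
    by_cases h : s < d
    · by_cases h' : s + t < d
      · have : t < d - s := by linarith
        simp [elapse, h, h', this, sub_sub]
      · have : ¬ t < d - s := by linarith
        simp only [elapse, h, h', this, if_true, if_false]
        congr 1; ring
    · have h' : ¬ s + t < d := by linarith
      simp only [elapse, h, h', if_false, ih]
      congr 1; ring

lemma elapse_eq_nil_iff {l : List ℝ} (hl : ∀ d ∈ l, 0 < d) {t : ℝ} (ht : 0 ≤ t) :
    elapse l t = [] ↔ l.sum ≤ t := by
  induction l generalizing t with
  | nil => simpa [elapse] using ht
  | cons d l ih =>
    have hl' : ∀ d ∈ l, 0 < d := fun e he => hl e (by simp [he])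
    have hs : 0 ≤ l.sum := List.sum_nonneg fun e he => (hl' e he).le
    by_cases h : t < d
    · simp only [elapse, h, if_true, List.sum_cons, reduceCtorEq, false_iff]
      linarith
    · simp only [elapse, h, if_false, List.sum_cons]
      rw [ih hl' (by linarith)]
      constructor <;> intro <;> linarith

lemma length_elapse_le (l : List ℝ) (t : ℝ) : (elapse l t).length ≤ l.length := by
  induction l generalizing t with
  | nil => simp [elapse]
  | cons d l ih =>
    unfold elapse
    split_ifs
    · simp
    · exact (ih _).trans (by simp)

/-- What is left of the preparation completed last, at the moment when the first of the two
preparations with residual phases `z` and `x` is completed. -/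
noncomputable def leftover (z x : List ℝ) : List ℝ :=
  if x.sum ≤ z.sum then elapse z x.sum else elapse x z.sum

lemma elapse_leftover (z x : List ℝ) {t : ℝ} (ht : 0 ≤ t) :
    elapse (leftover z x) t =
      if x.sum ≤ z.sum then elapse z (x.sum + t) else elapse x (z.sum + t) := by
  unfold leftover
  split_ifs <;> exact elapse_elapse _ _ ht

lemma measurable_leftover : Measurable fun p : List ℝ × List ℝ => leftover p.1 p.2 :=
  Measurable.ite (measurableSet_le (by fun_prop) (by fun_prop)) (by fun_prop) (by fun_prop)

@[fun_prop]
lemma Measurable.leftover {α : Type*} [MeasurableSpace α] {f g : α → List ℝ}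
    (hf : Measurable f) (hg : Measurable g) : Measurable fun a => leftover (f a) (g a) :=
  measurable_leftover.comp (hf.prodMk hg)

/-- Let the current phases of both preparations run until the first of them ends. -/
lemma leftover_cons_cons (d e : ℝ) {z x : List ℝ} (hz : 0 ≤ z.sum) (hx : 0 ≤ x.sum) :
    leftover (d :: z) (e :: x) =
      if d < e then leftover z ((e - d) :: x) else leftover ((d - e) :: z) x := by
  unfold leftover
  by_cases hde : d < e
  · simp only [hde, if_true, List.sum_cons]
    by_cases hc : e + x.sum ≤ d + z.sum
    · have hc' : e - d + x.sum ≤ z.sum := by linarith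
      have h : ¬ e + x.sum < d := by linarith
      simp only [hc, hc', elapse, h, if_true, if_false]
      congr 1; ring
    · have hc' : ¬ e - d + x.sum ≤ z.sum := by linarith
      have h : d + z.sum < e ↔ z.sum < e - d := by constructor <;> intro <;> linarith
      simp only [hc, hc', elapse, h, if_false]
      split_ifs <;> congr 1 <;> ring
  · simp only [hde, if_false, List.sum_cons]
    by_cases hc : e + x.sum ≤ d + z.sum
    · have hc' : x.sum ≤ d - e + z.sum := by linarith
      have h : e + x.sum < d ↔ x.sum < d - e := by constructor <;> intro <;> linarith
      simp only [hc, hc', elapse, h, if_true]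
      split_ifs <;> congr 1 <;> ring
    · have hc' : ¬ x.sum ≤ d - e + z.sum := by linarith
      have h : ¬ d + z.sum < e := by linarith
      simp only [hc, hc', elapse, h, if_false]
      congr 1; ring

/-! ### Lists of independent exponential phases -/

/-- The law of a list of `k` independent phases, exponential with parameter `μ`. -/
noncomputable def phaseLaw (μ : ℝ) : ℕ → Measure (List ℝ)
  | 0 => Measure.dirac []
  | k + 1 => ((expMeasure μ).prod (phaseLaw μ k)).map fun p => p.1 :: p.2

section PhaseLaw

variable {μ : ℝ} [hμ : Fact (0 < μ)]

instance (k : ℕ) : IsProbabilityMeasure (phaseLaw μ k) := by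
  induction k with
  | zero => unfold phaseLaw; infer_instance
  | succ k ih =>
    unfold phaseLaw
    exact Measure.isProbabilityMeasure_map (by fun_prop)

omit hμ in
lemma lintegral_phaseLaw_zero {f : List ℝ → ℝ≥0∞} (hf : Measurable f) :
    ∫⁻ l, f l ∂phaseLaw μ 0 = f [] :=
  lintegral_dirac' _ hf

lemma lintegral_phaseLaw_succ (k : ℕ) {f : List ℝ → ℝ≥0∞} (hf : Measurable f) :
    ∫⁻ l, f l ∂phaseLaw μ (k + 1) = ∫⁻ d, ∫⁻ l, f (d :: l) ∂phaseLaw μ k ∂expMeasure μ := by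
  rw [phaseLaw, lintegral_map hf (by fun_prop), lintegral_prod _ (by fun_prop)]

lemma map_ofFn_pi_expMeasure (k : ℕ) :
    (Measure.pi fun _ : Fin k => expMeasure μ).map List.ofFn = phaseLaw μ k := by
  induction k with
  | zero =>
    rw [Measure.pi_of_empty _ Fin.elim0, Measure.map_dirac' measurable_ofFn, phaseLaw]
    simp
  | succ k ih =>
    rw [← ((measurePreserving_piFinSuccAbove (fun _ => expMeasure μ) 0).symm).map_eq,
      Measure.map_map measurable_ofFn (by fun_prop), phaseLaw, ← ih,
      ← Measure.map_id (μ := expMeasure μ), Measure.map_prod_map _ _ measurable_id measurable_ofFn,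
      Measure.map_map (by fun_prop) (by fun_prop), Measure.map_id]
    congr 1
    ext p : 1
    simp [MeasurableEquiv.piFinSuccAbove, List.ofFn_succ, Fin.insertNthEquiv]

lemma map_take_phaseLaw {i n : ℕ} (h : i ≤ n) :
    (phaseLaw μ n).map (List.take i) = phaseLaw μ i := by
  refine Measure.ext_of_lintegral _ fun f hf => ?_
  rw [lintegral_map hf (measurable_take i)]
  induction n generalizing i f with
  | zero =>
    obtain rfl : i = 0 := by omega
    simp [lintegral_phaseLaw_zero hf]
  | succ n ih =>
    rw [lintegral_phaseLaw_succ (f := fun l => f (List.take i l)) _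
      (hf.comp (measurable_take i))]
    cases i with
    | zero => simp [lintegral_phaseLaw_zero hf]
    | succ i =>
      rw [lintegral_phaseLaw_succ _ hf]
      refine lintegral_congr fun d => ?_
      simpa using ih (f := fun l => f (d :: l)) (by omega) (by fun_prop)

lemma measurableSet_forall_mem_pos : MeasurableSet {l : List ℝ | ∀ d ∈ l, 0 < d} := by
  have : {l : List ℝ | ∀ d ∈ l, 0 < d}
      = ⋂ i : ℕ, {l : List ℝ | i < l.length → 0 < l.getD i 0} := by
    ext l
    simp only [Set.mem_ofPred_eq, Set.mem_iInter, List.forall_mem_iff_getElem]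
    refine forall_congr' fun i => forall_congr' fun hi => ?_
    simp [hi]
  rw [this]
  refine MeasurableSet.iInter fun i => ?_
  have h₁ : MeasurableSet {l : List ℝ | i < l.length} := measurable_length measurableSet_Ioi
  have h₂ : MeasurableSet {l : List ℝ | 0 < l.getD i 0} := measurable_getD i measurableSet_Ioi
  exact h₁.imp h₂

lemma ae_phaseLaw (k : ℕ) : ∀ᵐ l ∂phaseLaw μ k, l.length = k ∧ ∀ d ∈ l, 0 < d := by
  have hm : ∀ k, MeasurableSet {l : List ℝ | l.length = k ∧ ∀ d ∈ l, 0 < d} := fun k =>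
    (measurable_length (measurableSet_singleton k)).inter measurableSet_forall_mem_pos
  induction k with
  | zero => exact (ae_dirac_iff (hm 0)).2 (by simp)
  | succ k ih =>
    rw [phaseLaw, ae_map_iff (by fun_prop) (hm _)]
    refine Measure.ae_prod_iff_ae_ae ((by fun_prop : Measurable fun p : ℝ × List ℝ => p.1 :: p.2)
      (hm (k + 1))) |>.2 ?_
    filter_upwards [ae_pos_expMeasure] with d hd
    filter_upwards [ih] with l hl
    simpa [hl.1, hd] using hl.2

lemma ae_sum_nonneg_phaseLaw (k : ℕ) : ∀ᵐ l ∂phaseLaw μ k, 0 ≤ l.sum := by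
  filter_upwards [ae_phaseLaw k] with l hl
  exact List.sum_nonneg fun d hd => (hl.2 d hd).le

/-- Phases run off like a Poisson process: this is the law of the residual phases after a fixed
time `t`. -/
lemma lintegral_elapse (k : ℕ) {t : ℝ} (ht : 0 ≤ t) {f : List ℝ → ℝ≥0∞} (hf : Measurable f) :
    ∫⁻ l, f (elapse l t) ∂phaseLaw μ k
      = ∑ j ∈ Finset.range k,
          ENNReal.ofReal (poissonWeight μ j t) * ∫⁻ l, f l ∂phaseLaw μ (k - j)
        + (∑' m, ENNReal.ofReal (poissonWeight μ (k + m) t)) * f [] := by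
  induction k generalizing t with
  | zero =>
    rw [lintegral_phaseLaw_zero (f := fun l => f (elapse l t)) (by fun_prop)]
    have h := hasSum_poissonWeight (μ := μ) t
    rw [← ENNReal.ofReal_tsum_of_nonneg (fun m => poissonWeight_nonneg _ ht)
      (by simpa using h.summable)]
    simp [elapse, h.tsum_eq]
  | succ k ih =>
    rw [lintegral_phaseLaw_succ _ (by fun_prop)]
    have hG : Measurable fun d => ∫⁻ l, f (d :: l) ∂phaseLaw μ k :=
      Measurable.lintegral_prod_right' (f := fun p : ℝ × List ℝ => f (p.1 :: p.2)) (by fun_prop)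
    have hw : ∀ m, Measurable fun d : ℝ => if t < d then (0 : ℝ≥0∞)
        else ENNReal.ofReal (poissonWeight μ m (t - d)) := fun m =>
      Measurable.ite measurableSet_Ioi measurable_const (by fun_prop)
    -- either the first phase `d` outlives `t`, or the later phases run for the time `t - d`
    have key : ∀ d, ∫⁻ l, f (elapse (d :: l) t) ∂phaseLaw μ k
        = (if t < d then (fun u => ∫⁻ l, f (u :: l) ∂phaseLaw μ k) (d - t) else 0)
          + (∑ j ∈ Finset.range k,
              (if t < d then 0 else ENNReal.ofReal (poissonWeight μ j (t - d)))
                * ∫⁻ l, f l ∂phaseLaw μ (k - j)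
            + (∑' m, if t < d then 0 else ENNReal.ofReal (poissonWeight μ (k + m) (t - d)))
              * f []) := by
      intro d
      by_cases h : t < d
      · simp [elapse, h]
      · simp only [elapse, h, if_false, zero_add]
        exact ih (by linarith)
    simp_rw [key]
    rw [lintegral_add_left (Measurable.ite measurableSet_Ioi (by fun_prop) measurable_const),
      lintegral_overshoot_lt ht hG, lintegral_add_left (by fun_prop),
      lintegral_finsetSum _ (by fun_prop), lintegral_mul_const _ (by fun_prop),
      lintegral_tsum (by fun_prop)]
    simp_rw [lintegral_mul_const _ (hw _), lintegral_poissonWeight_sub _ ht]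
    rw [Finset.sum_range_succ', ← lintegral_phaseLaw_succ _ hf]
    simp only [Nat.add_sub_add_right, Nat.sub_zero, add_right_comm k _ 1]
    rw [show ENNReal.ofReal (poissonWeight μ 0 t) = ENNReal.ofReal (Real.exp (-(μ * t))) by
      simp [poissonWeight]]
    ring

omit hμ in
lemma erlangCDF_eq_tsum (k : ℕ) {x : ℝ} (hx : 0 ≤ x) :
    erlangCDF μ k x = ∑' m, poissonWeight μ (k + m) x := by
  have h := hasSum_poissonWeight (μ := μ) x
  have := h.summable.sum_add_tsum_nat_add k
  rw [h.tsum_eq] at this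
  simp only [erlangCDF, not_lt.2 hx, if_false, Finset.mul_sum]
  simp only [poissonWeight, mul_div_assoc] at this ⊢
  simp only [add_comm k]
  linarith

lemma erlangCDF_nonneg (k : ℕ) (x : ℝ) : 0 ≤ erlangCDF μ k x := by
  rcases lt_or_ge x 0 with hx | hx
  · simp [erlangCDF, hx]
  · rw [erlangCDF_eq_tsum k hx]
    exact tsum_nonneg fun m => poissonWeight_nonneg _ hx

omit hμ in
lemma mixedErlangCDF_eq_sum {n : ℕ} (w : Fin (n + 1) → ℝ) (x : ℝ) :
    mixedErlangCDF μ w x = ∑ i : Fin (n + 1), w i * erlangCDF μ i x := by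
  rcases lt_or_ge x 0 with hx | hx
  · simp [mixedErlangCDF, erlangCDF, hx]
  · rw [mixedErlangCDF, if_neg (not_lt.2 hx), Fin.sum_univ_succ]
    simp [erlangCDF, not_lt.2 hx]

/-- For `x ≥ 0`, the total duration of the phases is at most `x` iff none of them is left at time
`x`. -/
lemma measure_sum_le_phaseLaw (k : ℕ) (x : ℝ) :
    phaseLaw μ k {l | l.sum ≤ x} = ENNReal.ofReal (erlangCDF μ k x) := by
  have hμ0 := hμ.out
  rcases lt_or_ge x 0 with hx | hx
  · rw [erlangCDF, if_pos hx, ENNReal.ofReal_zero, measure_eq_zero_iff_ae_notMem]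
    filter_upwards [ae_sum_nonneg_phaseLaw k] with l hl
    simpa using hx.trans_le hl
  have hnil : MeasurableSet {l : List ℝ | l.length = 0} :=
    measurable_length (measurableSet_singleton 0)
  set f : List ℝ → ℝ≥0∞ := fun l => if l.length = 0 then 1 else 0
  have hfm : Measurable f := Measurable.ite hnil measurable_const measurable_const
  have h₁ : phaseLaw μ k {l | l.sum ≤ x} = ∫⁻ l, f (elapse l x) ∂phaseLaw μ k := by
    rw [← lintegral_indicator_one (measurableSet_le measurable_sum_list measurable_const)]
    refine lintegral_congr_ae ?_
    filter_upwards [ae_phaseLaw k] with l hl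
    simp [f, Set.indicator_apply, List.length_eq_zero_iff, elapse_eq_nil_iff hl.2 hx]
  have h₂ : ∀ j ∈ Finset.range k, ENNReal.ofReal (poissonWeight μ j x)
      * ∫⁻ l, f l ∂phaseLaw μ (k - j) = 0 := by
    intro j hj
    have : ∫⁻ l, f l ∂phaseLaw μ (k - j) = 0 := by
      rw [← lintegral_zero (μ := phaseLaw μ (k - j))]
      refine lintegral_congr_ae ?_
      filter_upwards [ae_phaseLaw (k - j)] with l hl
      have := Finset.mem_range.1 hj
      have : l.length ≠ 0 := by omega
      simp only [f, this, if_false]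
    rw [this, mul_zero]
  have h := hasSum_poissonWeight (μ := μ) x
  rw [h₁, lintegral_elapse k hx hfm, Finset.sum_eq_zero h₂, zero_add,
    ← ENNReal.ofReal_tsum_of_nonneg (fun m => poissonWeight_nonneg _ hx)
      (by simpa [add_comm] using (summable_nat_add_iff k).2 h.summable)]
  rw [← erlangCDF_eq_tsum k hx]
  simp [f]

/-- The weights in a mixture can be recovered from the length of the list. -/
lemma restrict_length_sum {n : ℕ} (c : Fin (n + 1) → ℝ≥0∞) (j : Fin (n + 1)) :
    (∑ i : Fin (n + 1), c i • phaseLaw μ i).restrict {l | l.length = j} = c j • phaseLaw μ j := by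
  have hL : MeasurableSet {l : List ℝ | l.length = j} :=
    measurable_length (measurableSet_singleton (j : ℕ))
  have hsum : (∑ i : Fin (n + 1), c i • phaseLaw μ i).restrict {l | l.length = j}
      = ∑ i : Fin (n + 1), (c i • phaseLaw μ i).restrict {l | l.length = j} := by
    ext S hS
    simp [Measure.restrict_apply hS, Measure.finsetSum_apply]
  rw [hsum]
  rw [Finset.sum_eq_single j]
  · rw [Measure.restrict_smul, Measure.restrict_eq_self_of_ae_mem]
    filter_upwards [ae_phaseLaw j] with l hl using hl.1
  · intro i _ hij
    rw [Measure.restrict_smul, Measure.restrict_eq_zero.2, smul_zero]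
    rw [measure_eq_zero_iff_ae_notMem]
    filter_upwards [ae_phaseLaw i] with l hl h
    exact hij (Fin.ext (hl.1.symm.trans h))
  · simp

/-! ### The race between two preparations -/

/-- The probability that `k` phases are left of the preparation completed last, when the first of
two preparations with `i` and `m` exponential phases is completed. Each phase completion belongs to
either of the two preparations with probability `1/2`. -/
noncomputable def raceProb : ℕ → ℕ → ℕ → ℝ
  | 0, m, k => if k = m then 1 else 0
  | i + 1, 0, k => if k = i + 1 then 1 else 0
  | i + 1, m + 1, k => (raceProb i (m + 1) k + raceProb (i + 1) m k) / 2

lemma raceProb_nonneg (i m k : ℕ) : 0 ≤ raceProb i m k := by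
  fun_induction raceProb i m k with
  | case1 => exact zero_le_one
  | case2 => exact le_rfl
  | case3 => exact zero_le_one
  | case4 => exact le_rfl
  | case5 => positivity

lemma lintegral_leftover_succ_succ (i m : ℕ) {f : List ℝ → ℝ≥0∞} (hf : Measurable f) :
    ∫⁻ z, ∫⁻ x, f (leftover z x) ∂phaseLaw μ (m + 1) ∂phaseLaw μ (i + 1)
      = 2⁻¹ * ∫⁻ z, ∫⁻ x, f (leftover z x) ∂phaseLaw μ (m + 1) ∂phaseLaw μ i
        + 2⁻¹ * ∫⁻ z, ∫⁻ x, f (leftover z x) ∂phaseLaw μ m ∂phaseLaw μ (i + 1) := by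
  -- each of the two preparations consists of a current phase and a list of later phases
  have hm : ∀ j, Measurable fun z => ∫⁻ x, f (leftover z x) ∂phaseLaw μ j := fun j =>
    Measurable.lintegral_prod_right'
      (f := fun p : List ℝ × List ℝ => f (leftover p.1 p.2)) (by fun_prop)
  have h₁ : Measurable fun p : ℝ × List ℝ =>
      ∫⁻ x, f (leftover p.2 (p.1 :: x)) ∂phaseLaw μ m :=
    Measurable.lintegral_prod_right'
      (f := fun p : (ℝ × List ℝ) × List ℝ => f (leftover p.1.2 (p.1.1 :: p.2))) (by fun_prop)
  have h₂ : Measurable fun p : ℝ × List ℝ =>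
      ∫⁻ x, f (leftover (p.1 :: p.2) x) ∂phaseLaw μ m :=
    Measurable.lintegral_prod_right'
      (f := fun p : (ℝ × List ℝ) × List ℝ => f (leftover (p.1.1 :: p.1.2) p.2)) (by fun_prop)
  have h₃ : ∀ d, Measurable fun p : List ℝ × ℝ =>
      ∫⁻ x, f (leftover (d :: p.1) (p.2 :: x)) ∂phaseLaw μ m := fun d =>
    Measurable.lintegral_prod_right'
      (f := fun p : (List ℝ × ℝ) × List ℝ => f (leftover (d :: p.1.1) (p.1.2 :: p.2)))
      (by fun_prop)
  calc _ = ∫⁻ d, ∫⁻ e, ∫⁻ z, ∫⁻ x, f (leftover (d :: z) (e :: x))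
          ∂phaseLaw μ m ∂phaseLaw μ i ∂expMeasure μ ∂expMeasure μ := by
        rw [lintegral_phaseLaw_succ _ (hm _)]
        refine lintegral_congr fun d => ?_
        rw [← lintegral_lintegral_swap (f := fun z e =>
          ∫⁻ x, f (leftover (d :: z) (e :: x)) ∂phaseLaw μ m) (h₃ d).aemeasurable]
        exact lintegral_congr fun z => lintegral_phaseLaw_succ _ (by fun_prop)
    _ = ∫⁻ d, ∫⁻ e, (if d < e
          then ∫⁻ z, ∫⁻ x, f (leftover z ((e - d) :: x)) ∂phaseLaw μ m ∂phaseLaw μ i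
          else ∫⁻ z, ∫⁻ x, f (leftover ((d - e) :: z) x) ∂phaseLaw μ m ∂phaseLaw μ i)
          ∂expMeasure μ ∂expMeasure μ := by
        refine lintegral_congr fun d => lintegral_congr fun e => ?_
        rw [← apply_ite (fun g : List ℝ → ℝ≥0∞ => ∫⁻ z, g z ∂phaseLaw μ i)]
        refine lintegral_congr_ae ?_
        filter_upwards [ae_sum_nonneg_phaseLaw i] with z hz
        rw [ite_apply, ← apply_ite (fun g : List ℝ → ℝ≥0∞ => ∫⁻ x, g x ∂phaseLaw μ m)]
        refine lintegral_congr_ae ?_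
        filter_upwards [ae_sum_nonneg_phaseLaw m] with x hx
        rw [leftover_cons_cons d e hz hx]
        split_ifs <;> rfl
    _ = _ := by
        rw [lintegral_race
          (G₁ := fun u => ∫⁻ z, ∫⁻ x, f (leftover z (u :: x)) ∂phaseLaw μ m ∂phaseLaw μ i)
          (G₂ := fun u => ∫⁻ z, ∫⁻ x, f (leftover (u :: z) x) ∂phaseLaw μ m ∂phaseLaw μ i)
          h₁.lintegral_prod_right' h₂.lintegral_prod_right',
          lintegral_lintegral_swap (f := fun u z =>
            ∫⁻ x, f (leftover z (u :: x)) ∂phaseLaw μ m) h₁.aemeasurable,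
          lintegral_phaseLaw_succ i (hm m)]
        congr 3
        ext z
        exact (lintegral_phaseLaw_succ (f := fun x => f (leftover z x)) _ (by fun_prop)).symm

/-- The law of what is left of the preparation completed last. -/
lemma lintegral_leftover {i m N : ℕ} (hi : i ≤ N) (hm : m ≤ N) {f : List ℝ → ℝ≥0∞}
    (hf : Measurable f) :
    ∫⁻ z, ∫⁻ x, f (leftover z x) ∂phaseLaw μ m ∂phaseLaw μ i
      = ∑ k ∈ Finset.range (N + 1),
          ENNReal.ofReal (raceProb i m k) * ∫⁻ l, f l ∂phaseLaw μ k := by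
  have hmeas : ∀ j, Measurable fun z => ∫⁻ x, f (leftover z x) ∂phaseLaw μ j := fun j =>
    Measurable.lintegral_prod_right'
      (f := fun p : List ℝ × List ℝ => f (leftover p.1 p.2)) (by fun_prop)
  induction i generalizing m with
  | zero =>
    rw [lintegral_phaseLaw_zero (hmeas m)]
    have : ∫⁻ x, f (leftover [] x) ∂phaseLaw μ m = ∫⁻ x, f x ∂phaseLaw μ m := by
      refine lintegral_congr_ae ?_
      filter_upwards [ae_phaseLaw m] with x hx
      have h : leftover [] x = x := by
        unfold leftover
        split_ifs with h
        · exact ((elapse_eq_nil_iff hx.2 le_rfl).2 h).symm.trans (elapse_zero hx.2)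
        · exact elapse_zero hx.2
      rw [h]
    rw [this, Finset.sum_eq_single m]
    · simp [raceProb]
    · intro k _ hk
      simp [raceProb, hk]
    · intro h
      simp at h
      omega
  | succ i ihi =>
    induction m with
    | zero =>
      have : ∫⁻ z, ∫⁻ x, f (leftover z x) ∂phaseLaw μ 0 ∂phaseLaw μ (i + 1)
          = ∫⁻ z, f z ∂phaseLaw μ (i + 1) := by
        refine lintegral_congr_ae ?_
        filter_upwards [ae_phaseLaw (i + 1), ae_sum_nonneg_phaseLaw (i + 1)] with z hz hz'
        rw [lintegral_phaseLaw_zero (f := fun x => f (leftover z x)) (by fun_prop)]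
        simp [leftover, hz', elapse_zero hz.2]
      rw [this, Finset.sum_eq_single (i + 1)]
      · simp [raceProb]
      · intro k _ hk
        simp [raceProb, hk]
      · intro h
        simp at h
        omega
    | succ m ihm =>
      rw [lintegral_leftover_succ_succ i m hf, ihi (by omega) hm, ihm (by omega), Finset.mul_sum,
        Finset.mul_sum, ← Finset.sum_add_distrib]
      refine Finset.sum_congr rfl fun k _ => ?_
      rw [← mul_assoc, ← mul_assoc, ← add_mul, ← mul_add,
        ← ENNReal.ofReal_add (raceProb_nonneg _ _ _) (raceProb_nonneg _ _ _), raceProb,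
        div_eq_inv_mul, ENNReal.ofReal_mul (by norm_num), ENNReal.ofReal_inv_of_pos two_pos]
      simp

end PhaseLaw

/-! ### Closed form of the race probabilities -/

/-- The probability that, in the race between two preparations with `i` and `m` phases, the second
is completed first and leaves `k` phases of the first one: the last of `m + i - k` fair coin tosses
is the `m`-th success. -/
noncomputable def raceWin (i m k : ℕ) : ℝ :=
  if m = 0 then if k = i then 1 else 0
  else if k ≤ i then (1 / 2 : ℝ) ^ (m + i - k) * ((m + i - k - 1).choose (m - 1) : ℝ) else 0

lemma raceWin_succ_succ (i m : ℕ) {k : ℕ} (hk : k ≠ 0) :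
    raceWin (i + 1) (m + 1) k = (raceWin i (m + 1) k + raceWin (i + 1) m k) / 2 := by
  rcases lt_trichotomy k (i + 1) with h | rfl | h
  · obtain ⟨r, rfl⟩ : ∃ r, i = k + r := ⟨i - k, by omega⟩
    have e₁ : m + 1 + (k + r + 1) - k = m + r + 2 := by omega
    have e₂ : m + 1 + (k + r) - k = m + r + 1 := by omega
    have e₃ : m + (k + r + 1) - k = m + r + 1 := by omega
    have l₁ : k ≤ k + r + 1 := by omega
    have l₂ : k ≠ k + r + 1 := by omega
    simp only [raceWin, e₁, e₂, e₃, l₁, l₂, if_true, if_false, Nat.add_eq_zero_iff, one_ne_zero,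
      and_false, Nat.le_add_right, Nat.add_sub_cancel]
    cases m with
    | zero => simp; ring
    | succ m =>
      have : m + 1 + r + 2 - 1 = (m + r + 1) + 1 := by omega
      rw [this, Nat.choose_succ_succ]
      have : m + 1 + r = m + r + 1 := by omega
      simp only [this, Nat.add_eq_zero_iff, one_ne_zero, and_false, if_false, Nat.add_sub_cancel]
      push_cast
      ring
  · have e₁ : m + 1 + (i + 1) - (i + 1) = m + 1 := by omega
    have e₂ : m + (i + 1) - (i + 1) = m := by omega
    have l₁ : ¬ i + 1 ≤ i := by omega
    simp only [raceWin, e₁, e₂, l₁, le_refl, if_true, if_false, Nat.add_eq_zero_iff, one_ne_zero,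
      and_false, Nat.add_sub_cancel]
    cases m with
    | zero => simp
    | succ m => simp; ring
  · have l₁ : ¬ k ≤ i + 1 := by omega
    have l₂ : ¬ k ≤ i := by omega
    have l₃ : k ≠ i + 1 := by omega
    simp [raceWin, l₁, l₂, l₃]

lemma raceProb_eq_raceWin (i m : ℕ) {k : ℕ} (hk : k ≠ 0) :
    raceProb i m k = raceWin i m k + raceWin m i k := by
  induction i generalizing m with
  | zero =>
    by_cases hm : m = 0 <;> simp [raceProb, raceWin, hk, hm]
  | succ i ihi =>
    induction m with
    | zero => simp [raceProb, raceWin, hk]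
    | succ m ihm =>
      rw [raceProb, ihi, ihm, raceWin_succ_succ i m hk, raceWin_succ_succ m i hk]
      ring

/-- In `raceTerm` the two binomial coefficients stand for the two possible winners. That of the
first vanishes when `i < k`, as the other customer cannot have more phases left than it had. -/
lemma raceProb_eq_raceTerm {n i k : ℕ} (hn : 1 ≤ n) (hi : 1 ≤ i) (hk : 1 ≤ k) (hkn : k ≤ n) :
    raceProb i n k = raceTerm n i k := by
  have h₁ : raceWin i n k
      = (1 / 2 : ℝ) ^ (n + i - k) * ((n + i - k - 1).choose (n - 1) : ℝ) := by
    rw [raceWin, if_neg (by omega)]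
    split_ifs with h
    · rfl
    · rw [Nat.choose_eq_zero_of_lt (by omega)]
      simp
  have h₂ : raceWin n i k
      = (1 / 2 : ℝ) ^ (n + i - k) * ((n + i - k - 1).choose (n - k) : ℝ) := by
    rw [raceWin, if_neg (by omega), if_pos hkn, add_comm i n,
      Nat.choose_symm_of_eq_add (show n + i - k - 1 = (i - 1) + (n - k) by omega)]
  rw [raceProb_eq_raceWin i n (by omega), h₁, h₂, raceTerm, mul_add]

lemma raceProb_zero_right {i m : ℕ} (h : i + m ≠ 0) : raceProb i m 0 = 0 := by
  induction i generalizing m with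
  | zero => simp [raceProb]; omega
  | succ i ihi =>
    induction m with
    | zero => simp [raceProb]
    | succ m ihm => rw [raceProb, ihi (by omega), ihm (by omega)]; simp

/-! ### Phases completed during a service -/

section Service

variable {μ : ℝ} [hμ : Fact (0 < μ)] {ν : Measure ℝ} [IsProbabilityMeasure ν]

omit hμ [IsProbabilityMeasure ν] in
lemma ae_nonneg_of_measure_Iio (hν : ν (Set.Iio 0) = 0) : ∀ᵐ t ∂ν, 0 ≤ t := by
  filter_upwards [measure_eq_zero_iff_ae_notMem.1 hν] with t ht
  simpa using ht

/-- The term `(-μ)^m / m! * α^(m)(μ)` is the probability of `m` Poisson events during a service. -/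
lemma serviceTerm_eq_integral (hν : ν (Set.Iio 0) = 0) (m : ℕ) :
    serviceTerm μ ν m = ∫ t, poissonWeight μ m t ∂ν := by
  have hsub : Set.Iio 0 ⊆ integrableExpSet id ν := by
    intro s hs
    refine Integrable.of_bound (C := 1) (by fun_prop) ?_
    filter_upwards [ae_nonneg_of_measure_Iio hν] with t ht
    rw [Real.norm_of_nonneg (Real.exp_nonneg _), Real.exp_le_one_iff]
    exact mul_nonpos_of_nonpos_of_nonneg (le_of_lt hs) ht
  -- the moment generating function of `ν` is smooth on `(-∞, 0)`, as `ν` lives on `[0, ∞)`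
  have hint : -μ ∈ interior (integrableExpSet id ν) :=
    interior_maximal hsub isOpen_Iio (by simpa using hμ.out)
  have hl : laplace ν = fun s => mgf id ν (-s) := by
    ext s; simp [laplace, mgf]
  rw [serviceTerm, hl, iteratedDeriv_comp_neg, iteratedDeriv_mgf hint, smul_eq_mul,
    ← mul_assoc, ← integral_const_mul]
  refine integral_congr_ae (ae_of_all _ fun t => ?_)
  have h : (-μ) ^ m * (-1) ^ m = μ ^ m := by rw [← mul_pow]; simp
  simp only [id_eq, poissonWeight, mul_pow, neg_mul]
  rw [← h]
  ring

lemma integrable_poissonWeight (hν : ν (Set.Iio 0) = 0) (m : ℕ) :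
    Integrable (poissonWeight μ m) ν := by
  refine Integrable.of_bound (C := 1) (by fun_prop) ?_
  filter_upwards [ae_nonneg_of_measure_Iio hν] with t ht
  rw [Real.norm_of_nonneg (poissonWeight_nonneg m ht)]
  exact le_hasSum (hasSum_poissonWeight t) m fun j _ => poissonWeight_nonneg j ht

lemma lintegral_poissonWeight (hν : ν (Set.Iio 0) = 0) (m : ℕ) :
    ∫⁻ t, ENNReal.ofReal (poissonWeight μ m t) ∂ν = ENNReal.ofReal (serviceTerm μ ν m) := by
  rw [serviceTerm_eq_integral hν,
    ofReal_integral_eq_lintegral_ofReal (integrable_poissonWeight hν m)]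
  filter_upwards [ae_nonneg_of_measure_Iio hν] with t ht using poissonWeight_nonneg m ht

lemma serviceTerm_nonneg (hν : ν (Set.Iio 0) = 0) (m : ℕ) : 0 ≤ serviceTerm μ ν m := by
  rw [serviceTerm_eq_integral hν]
  refine integral_nonneg_of_ae ?_
  filter_upwards [ae_nonneg_of_measure_Iio hν] with t ht using poissonWeight_nonneg m ht

lemma summable_serviceTerm (hν : ν (Set.Iio 0) = 0) : Summable (serviceTerm μ ν) := by
  have h : ∑' m, ENNReal.ofReal (serviceTerm μ ν m) = 1 := by
    simp_rw [← lintegral_poissonWeight hν]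
    rw [← lintegral_tsum (by fun_prop)]
    have : ∀ᵐ t ∂ν, ∑' m, ENNReal.ofReal (poissonWeight μ m t) = 1 := by
      filter_upwards [ae_nonneg_of_measure_Iio hν] with t ht
      rw [← ENNReal.ofReal_tsum_of_nonneg (fun m => poissonWeight_nonneg m ht)
        (hasSum_poissonWeight t).summable, (hasSum_poissonWeight t).tsum_eq, ENNReal.ofReal_one]
    rw [lintegral_congr_ae this]
    simp
  have := ENNReal.summable_toReal (h.trans_ne ENNReal.one_ne_top)
  simpa only [ENNReal.toReal_ofReal (serviceTerm_nonneg hν _)] using this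

lemma serviceTerm_zero_pos (hν : ν (Set.Iio 0) = 0) : 0 < serviceTerm μ ν 0 := by
  rw [serviceTerm_eq_integral hν, integral_pos_iff_support_of_nonneg_ae]
  · have : Function.support (poissonWeight μ 0) = Set.univ := by
      ext t; simp [poissonWeight]
    simp [this]
  · filter_upwards [ae_nonneg_of_measure_Iio hν] with t ht using poissonWeight_nonneg 0 ht
  · exact integrable_poissonWeight hν 0

/-- The probability that `j` phases of a preparation with `k` remaining phases are left after a
service. -/
noncomputable def serviceProb (μ : ℝ) (ν : Measure ℝ) (k j : ℕ) : ℝ :=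
  if j = 0 then ∑' m, serviceTerm μ ν (k + m) else if j ≤ k then serviceTerm μ ν (k - j) else 0

lemma serviceProb_nonneg (hν : ν (Set.Iio 0) = 0) (k j : ℕ) : 0 ≤ serviceProb μ ν k j := by
  unfold serviceProb
  split_ifs
  · exact tsum_nonneg fun m => serviceTerm_nonneg hν _
  · exact serviceTerm_nonneg hν _
  · exact le_rfl

/-- The law of the residual phases after a service. -/
lemma lintegral_elapse_service (hν : ν (Set.Iio 0) = 0) {k n : ℕ} (hk : k ≤ n)
    {f : List ℝ → ℝ≥0∞} (hf : Measurable f) :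
    ∫⁻ l, ∫⁻ t, f (elapse l t) ∂ν ∂phaseLaw μ k
      = ∑ j ∈ Finset.range (n + 1),
          ENNReal.ofReal (serviceProb μ ν k j) * ∫⁻ l, f l ∂phaseLaw μ j := by
  have h₁ : ∀ᵐ t ∂ν, ∫⁻ l, f (elapse l t) ∂phaseLaw μ k
      = ∑ j ∈ Finset.range k,
          ENNReal.ofReal (poissonWeight μ j t) * ∫⁻ l, f l ∂phaseLaw μ (k - j)
        + (∑' m, ENNReal.ofReal (poissonWeight μ (k + m) t)) * f [] := by
    filter_upwards [ae_nonneg_of_measure_Iio hν] with t ht using lintegral_elapse k ht hf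
  rw [lintegral_lintegral_swap (by fun_prop), lintegral_congr_ae h₁,
    lintegral_add_left (by fun_prop), lintegral_finsetSum _ (by fun_prop),
    lintegral_mul_const _ (by fun_prop), lintegral_tsum (by fun_prop), Finset.sum_range_succ']
  have h₂ : ∀ j, ∫⁻ t, ENNReal.ofReal (poissonWeight μ j t) * ∫⁻ l, f l ∂phaseLaw μ (k - j) ∂ν
      = ENNReal.ofReal (serviceTerm μ ν j) * ∫⁻ l, f l ∂phaseLaw μ (k - j) := fun j => by
    rw [lintegral_mul_const _ (by fun_prop), lintegral_poissonWeight hν]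
  simp_rw [h₂, lintegral_poissonWeight hν]
  congr 1
  · rw [← Finset.sum_range_reflect]
    refine Finset.sum_subset_zero_on_sdiff (Finset.range_subset_range.2 hk) ?_ ?_
    · intro j hj
      have : ¬ j + 1 ≤ k := by simpa using (Finset.mem_sdiff.1 hj).2
      simp [serviceProb, this]
    · intro j hj
      have hj := Finset.mem_range.1 hj
      have e₁ : k - 1 - j = k - (j + 1) := by omega
      have e₂ : k - (k - (j + 1)) = j + 1 := by omega
      have e₃ : j + 1 ≤ k := hj
      simp [serviceProb, e₁, e₂, e₃]
  · rw [lintegral_phaseLaw_zero hf, serviceProb, if_pos rfl, ENNReal.ofReal_tsum_of_nonneg]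
    · exact fun m => serviceTerm_nonneg hν _
    · simpa [add_comm] using (summable_nat_add_iff k).2 (summable_serviceTerm (μ := μ) hν)

/-! ### The one-step law -/

omit hμ [IsProbabilityMeasure ν] in
/-- Between two service completions there is a race, followed by a service. -/
lemma transProb_eq_sum {n i j : ℕ} (hn : 1 ≤ n) (hjn : j ≤ n) :
    transProb n μ ν i j
      = ∑ k ∈ Finset.range (n + 1), raceProb i n k * serviceProb μ ν k j := by
  by_cases hi : i = 0
  · subst hi
    rw [Finset.sum_eq_single n (fun k _ hk => by simp [raceProb, hk]) (by simp)]
    by_cases hj : j = 0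
    · simp [transProb, raceProb, serviceProb, hj]
    · simp only [transProb, raceProb, serviceProb, hj, if_true, if_false, one_mul]
      rw [if_pos hjn]
  · have hsub : ∀ j', Finset.Icc (max 1 j') n ⊆ Finset.range (n + 1) := fun j' k hk => by
      simp at hk ⊢; omega
    rw [transProb, if_neg hi]
    split_ifs with hj
    · subst hj
      refine Finset.sum_subset_zero_on_sdiff (hsub 0) ?_ ?_
      · intro k hk
        have : k = 0 := by simp at hk; omega
        rw [this, raceProb_zero_right (by omega), zero_mul]
      · intro k hk
        have hk := Finset.mem_Icc.1 hk
        rw [raceProb_eq_raceTerm hn (by omega) (by omega) hk.2, serviceProb, if_pos rfl]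
    · have h1 : max 1 j = j := by omega
      refine Finset.sum_subset_zero_on_sdiff (h1 ▸ hsub j) ?_ ?_
      · intro k hk
        have : ¬ j ≤ k := by simp at hk; omega
        rw [serviceProb, if_neg hj, if_neg this, mul_zero]
      · intro k hk
        have hk := Finset.mem_Icc.1 hk
        rw [raceProb_eq_raceTerm hn (by omega) (by omega) hk.2, serviceProb, if_neg hj,
          if_pos hk.1]

/-- The residual phases of the other customer at a service completion, from those at the previous
service completion, the phases of the new customer and the service time. -/
noncomputable def step (z : List ℝ) (q : List ℝ × ℝ) : List ℝ :=
  if q.1.sum ≤ z.sum then elapse z (q.1.sum + q.2) else elapse q.1 (z.sum + q.2)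

lemma measurable_step : Measurable fun p : List ℝ × (List ℝ × ℝ) => step p.1 p.2 :=
  Measurable.ite (measurableSet_le (by fun_prop) (by fun_prop)) (by fun_prop) (by fun_prop)

/-- The one-step law: from a mixture of lists of independent exponential phases to a mixture of the
same form, the weights being transformed by the matrix `transProb`. -/
lemma map_step_sum {n : ℕ} (hn : 1 ≤ n) (hν : ν (Set.Iio 0) = 0) (c : Fin (n + 1) → ℝ≥0∞) :
    ((∑ i : Fin (n + 1), c i • phaseLaw μ i).prod ((phaseLaw μ n).prod ν)).map
        (fun p => step p.1 p.2)
      = ∑ j : Fin (n + 1),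
          (∑ i : Fin (n + 1), c i * ENNReal.ofReal (transProb n μ ν i j)) • phaseLaw μ j := by
  refine Measure.ext_of_lintegral _ fun f hf => ?_
  have hstep : Measurable fun p : List ℝ × (List ℝ × ℝ) => f (step p.1 p.2) :=
    hf.comp measurable_step
  have one : ∀ i : Fin (n + 1), ∫⁻ z, ∫⁻ q, f (step z q) ∂(phaseLaw μ n).prod ν ∂phaseLaw μ i
      = ∑ j : Fin (n + 1), ENNReal.ofReal (transProb n μ ν i j) * ∫⁻ l, f l ∂phaseLaw μ j := by
    intro i
    have hg : Measurable fun l => ∫⁻ t, f (elapse l t) ∂ν :=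
      Measurable.lintegral_prod_right' (f := fun p : List ℝ × ℝ => f (elapse p.1 p.2))
        (by fun_prop)
    have h : ∀ z, ∫⁻ q, f (step z q) ∂(phaseLaw μ n).prod ν
        = ∫⁻ x, (fun l => ∫⁻ t, f (elapse l t) ∂ν) (leftover z x) ∂phaseLaw μ n := by
      intro z
      rw [lintegral_prod (fun q => f (step z q)) (hstep.comp measurable_prodMk_left).aemeasurable]
      refine lintegral_congr fun x => lintegral_congr_ae ?_
      filter_upwards [ae_nonneg_of_measure_Iio hν] with t ht
      rw [elapse_leftover z x ht]
      rfl
    simp_rw [h]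
    rw [lintegral_leftover (Nat.lt_succ_iff.1 i.2) le_rfl hg]
    have h' : ∀ k ∈ Finset.range (n + 1),
        ENNReal.ofReal (raceProb i n k) * ∫⁻ l, ∫⁻ t, f (elapse l t) ∂ν ∂phaseLaw μ k
        = ∑ j : Fin (n + 1), ENNReal.ofReal (raceProb i n k * serviceProb μ ν k j)
            * ∫⁻ l, f l ∂phaseLaw μ j := by
      intro k hk
      rw [lintegral_elapse_service hν (Nat.lt_succ_iff.1 (Finset.mem_range.1 hk)) hf,
        Finset.sum_range, Finset.mul_sum]
      refine Finset.sum_congr rfl fun j _ => ?_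
      rw [ENNReal.ofReal_mul (raceProb_nonneg _ _ _), mul_assoc]
    rw [Finset.sum_congr rfl h', Finset.sum_comm]
    refine Finset.sum_congr rfl fun j _ => ?_
    rw [transProb_eq_sum hn (Nat.lt_succ_iff.1 j.2), ENNReal.ofReal_sum_of_nonneg
      fun k _ => mul_nonneg (raceProb_nonneg _ _ _) (serviceProb_nonneg hν _ _), Finset.sum_mul]
  rw [lintegral_map hf measurable_step, lintegral_prod _ hstep.aemeasurable,
    lintegral_finsetSum_measure, lintegral_finsetSum_measure]
  simp_rw [lintegral_smul_measure, smul_eq_mul, one, Finset.mul_sum, Finset.sum_mul]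
  rw [Finset.sum_comm]
  simp_rw [mul_assoc]

lemma map_step_phaseLaw {n : ℕ} (hn : 1 ≤ n) (hν : ν (Set.Iio 0) = 0) (c : ℝ≥0∞)
    (i : Fin (n + 1)) :
    ((c • phaseLaw μ i).prod ((phaseLaw μ n).prod ν)).map (fun p => step p.1 p.2)
      = ∑ j : Fin (n + 1), (c * ENNReal.ofReal (transProb n μ ν i j)) • phaseLaw μ j := by
  simpa [Finset.sum_ite_eq'] using
    map_step_sum (μ := μ) hn hν (fun k => if k = i then c else 0)

lemma transProb_nonneg {n i j : ℕ} (hn : 1 ≤ n) (hj : j ≤ n) (hν : ν (Set.Iio 0) = 0) :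
    0 ≤ transProb n μ ν i j := by
  rw [transProb_eq_sum hn hj]
  exact Finset.sum_nonneg fun k _ =>
    mul_nonneg (raceProb_nonneg _ _ _) (serviceProb_nonneg hν _ _)

lemma sum_transProb {n : ℕ} (hn : 1 ≤ n) (hν : ν (Set.Iio 0) = 0) (i : Fin (n + 1)) :
    ∑ j : Fin (n + 1), transProb n μ ν i j = 1 := by
  have h := congrArg (fun m : Measure (List ℝ) => m Set.univ)
    (map_step_phaseLaw (μ := μ) hn hν 1 i)
  simp_rw [one_smul, one_mul] at h
  have := Measure.isProbabilityMeasure_map (μ := (phaseLaw μ i).prod ((phaseLaw μ n).prod ν))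
    measurable_step.aemeasurable
  simp only [measure_univ, Measure.finsetSum_apply, Measure.smul_apply, smul_eq_mul, mul_one] at h
  rw [← ENNReal.ofReal_sum_of_nonneg
    fun j _ => transProb_nonneg hn (Nat.lt_succ_iff.1 j.2) hν] at h
  exact (ENNReal.ofReal_eq_one.1 h.symm)

/-- From each state the chain moves to `n` with a probability bounded below: it may happen that all
phases of the other customer are completed before the first phase of the new one, and that no phase
is completed during the service. -/
lemma exists_pos_le_transProb {n : ℕ} (hn : 1 ≤ n) (hν : ν (Set.Iio 0) = 0) :
    ∃ δ > 0, ∀ i ≤ n, δ ≤ transProb n μ ν i n := by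
  have h0 := serviceTerm_zero_pos (μ := μ) hν
  refine ⟨(1 / 2) ^ n * serviceTerm μ ν 0, by positivity, fun i hi => ?_⟩
  have hn0 : n ≠ 0 := by omega
  by_cases h : i = 0
  · simp only [transProb, h, hn0, if_true, if_false, Nat.sub_self]
    exact mul_le_of_le_one_left h0.le (pow_le_one₀ (by norm_num) (by norm_num))
  · simp only [transProb, h, hn0, if_false, Finset.Icc_self, Finset.sum_singleton, Nat.sub_self]
    refine mul_le_mul_of_nonneg_right ?_ h0.le
    have e : n + i - n = i := by omega
    rw [raceTerm, e, Nat.sub_self, Nat.choose_zero_right, Nat.cast_one]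
    calc (1 / 2 : ℝ) ^ n ≤ (1 / 2) ^ i := pow_le_pow_of_le_one (by norm_num) (by norm_num) hi
      _ ≤ (1 / 2) ^ i * (((i - 1).choose (n - 1) : ℝ) + 1) :=
        le_mul_of_one_le_right (by positivity) (by simp)

end Service

/-! ### The past of the system -/

section Past

variable {Ω : Type*} {n : ℕ} {K : Ω → Fin (n + 1)} {X : ℕ → Fin n → Ω → ℝ} {A : ℕ → Ω → ℝ}

lemma residual_succ (m : ℕ) (ω : Ω) :
    residual K X A (m + 1) ω
      = step (residual K X A m ω) (List.ofFn fun l => X (m + 1) l ω, A m ω) := rfl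

lemma phases_le (m : ℕ) (ω : Ω) : phases K X A m ω ≤ n := by
  induction m with
  | zero =>
    simp [phases, residual]
  | succ m ih =>
    rw [phases, residual_succ, step]
    split_ifs
    · exact (length_elapse_le _ _).trans ih
    · exact (length_elapse_le _ _).trans (by simp)

lemma measurable_residual [MeasurableSpace Ω] (m : ℕ) (hK : Measurable K)
    (hX : ∀ c ≤ m, ∀ l, Measurable (X c l)) (hA : ∀ r < m, Measurable (A r)) :
    Measurable (residual K X A m) := by
  induction m with
  | zero =>
    have ht : Measurable fun p : List ℝ × Fin (n + 1) => p.1.take p.2 :=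
      measurable_from_prod_countable_left fun k => measurable_take k
    have h0 : Measurable fun ω => List.ofFn fun l => X 0 l ω :=
      measurable_ofFn.comp (measurable_pi_lambda _ fun l => hX 0 le_rfl l)
    exact ht.comp (h0.prodMk hK)
  | succ m ih =>
    have h1 : Measurable fun ω => List.ofFn fun l => X (m + 1) l ω :=
      measurable_ofFn.comp (measurable_pi_lambda _ fun l => hX (m + 1) le_rfl l)
    exact measurable_step.comp
      ((ih (fun c hc => hX c (by omega)) fun r hr => hA r (by omega)).prodMk
        (h1.prodMk (hA m (by omega))))

variable (K X A) in
/-- The σ-algebras generated by the sources of randomness: the initial number of phases (index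
`none`), the durations of the phases and the service times. -/
abbrev sourceAlg : Option (ℕ × Fin n ⊕ ℕ) → MeasurableSpace Ω
  | none => MeasurableSpace.comap K inferInstance
  | some k => MeasurableSpace.comap (Sum.elim (fun p : ℕ × Fin n => X p.1 p.2) A k) inferInstance

/-- The sources of randomness that are used up to the `m`-th service completion: the phases of the
customers `0, …, m` and the first `m` service times. -/
def pastIndex (n m : ℕ) : Set (Option (ℕ × Fin n ⊕ ℕ)) :=
  {o | ∀ k, o = some k → Sum.elim (fun p : ℕ × Fin n => p.1 ≤ m) (fun r => r < m) k}

variable (K X A) in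
/-- The events determined by what happens up to the `m`-th service completion. -/
abbrev past (m : ℕ) : MeasurableSpace Ω := ⨆ o ∈ pastIndex n m, sourceAlg K X A o

lemma past_mono {m m' : ℕ} (h : m ≤ m') : past K X A m ≤ past K X A m' := by
  refine biSup_mono fun o ho k hk => ?_
  have := ho k hk
  cases k with
  | inl p => exact le_trans this h
  | inr r => exact lt_of_lt_of_le this h

lemma measurable_residual_past (m : ℕ) : Measurable[past K X A m] (residual K X A m) := by
  have hle : ∀ o ∈ pastIndex n m, sourceAlg K X A o ≤ past K X A m := fun o ho =>
    le_biSup (sourceAlg K X A) ho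
  refine @measurable_residual Ω n K X A (past K X A m) m ?_ (fun c hc l => ?_) fun r hr => ?_
  · exact (comap_measurable K).mono (hle none (by simp [pastIndex])) le_rfl
  · exact (comap_measurable (X c l)).mono (hle (some (Sum.inl (c, l))) (by simpa [pastIndex]))
      le_rfl
  · exact (comap_measurable (A r)).mono (hle (some (Sum.inr r)) (by simpa [pastIndex])) le_rfl

lemma measurableSet_phases_eq_past (m k : ℕ) :
    MeasurableSet[past K X A m] {ω | phases K X A m ω = k} :=
  measurable_residual_past m (measurable_length (measurableSet_singleton k))

lemma measurableSet_history_past (m : ℕ) (s : ℕ → ℕ) :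
    MeasurableSet[past K X A m] {ω | ∀ r ≤ m, phases K X A r ω = s r} := by
  have : {ω | ∀ r ≤ m, phases K X A r ω = s r}
      = ⋂ r ∈ Set.Iic m, {ω | phases K X A r ω = s r} := by
    ext ω; simp
  rw [this]
  exact MeasurableSet.biInter (Set.to_countable _) fun r hr =>
    past_mono hr _ (measurableSet_phases_eq_past r (s r))

end Past

/-! ### Independence of the past and the new customer -/

section Law

variable {Ω : Type*} [MeasurableSpace Ω] {P : Measure Ω} {n : ℕ}
  {K : Ω → Fin (n + 1)} {X : ℕ → Fin n → Ω → ℝ} {A : ℕ → Ω → ℝ} {μ : ℝ} {ν : Measure ℝ}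

namespace IsModel

variable (hM : IsModel K X A P μ ν)
include hM

lemma sourceAlg_le (o : Option (ℕ × Fin n ⊕ ℕ)) : sourceAlg K X A o ≤ ‹MeasurableSpace Ω› := by
  rcases o with _ | ⟨c, l⟩ | r
  · exact hM.measurable_init.comap_le
  · exact (hM.measurable_phase c l).comap_le
  · exact (hM.measurable_service r).comap_le

lemma past_le (m : ℕ) : past K X A m ≤ ‹MeasurableSpace Ω› :=
  iSup₂_le fun o _ => hM.sourceAlg_le o

lemma measurable_residual (m : ℕ) : Measurable (residual K X A m) :=
  (measurable_residual_past m).mono (hM.past_le m) le_rfl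

lemma iIndep_sourceAlg : iIndep (sourceAlg K X A) P := by
  have hY := (iIndepFun_iff_iIndep _ _ _).1 hM.indep
  have hK := (Indep_iff _ _ _).1 ((IndepFun_iff_Indep _ _ _).1 hM.indep_init)
  rw [iIndep_iff] at hY ⊢
  intro s f hf
  have hsome : P (⋂ k ∈ s.eraseNone, f (some k)) = ∏ k ∈ s.eraseNone, P (f (some k)) :=
    hY _ fun k hk => hf (some k) (Finset.mem_eraseNone.1 hk)
  by_cases h : none ∈ s
  · have hs : s = Finset.insertNone s.eraseNone := by simp [Finset.insert_eq_of_mem h]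
    have hinter : ⋂ i ∈ s, f i = f none ∩ ⋂ k ∈ s.eraseNone, f (some k) := by
      ext ω
      simp [Option.forall, h]
    rw [hinter, hK _ _ (hf none h), hsome]
    · conv_rhs => rw [hs, Finset.prod_insertNone]
    · refine Finset.measurableSet_biInter _ fun k hk => ?_
      have := hf (some k) (Finset.mem_eraseNone.1 hk)
      refine MeasurableSpace.comap_mono (measurable_pi_apply k).comap_le _ ?_
      rw [MeasurableSpace.comap_comp]
      exact this
  · have hs : s = s.eraseNone.map Function.Embedding.some := by simp [Finset.erase_eq_of_notMem h]
    have hinter : ⋂ i ∈ s, f i = ⋂ k ∈ s.eraseNone, f (some k) := by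
      ext ω
      simp [Option.forall, h]
    rw [hinter, hsome]
    conv_rhs => rw [hs, Finset.prod_map]
    rfl

lemma measurable_phases_customer (c : ℕ) : Measurable fun ω => List.ofFn fun l => X c l ω :=
  measurable_ofFn.comp (measurable_pi_lambda _ fun l => hM.measurable_phase c l)

omit hM [MeasurableSpace Ω] in
lemma measurable_phases_customer_iSup (c : ℕ) {S : Set (Option (ℕ × Fin n ⊕ ℕ))}
    (hS : ∀ l, some (Sum.inl (c, l)) ∈ S) :
    Measurable[⨆ o ∈ S, sourceAlg K X A o] fun ω => List.ofFn fun l => X c l ω := by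
  refine measurable_ofFn.comp (@measurable_pi_lambda _ _ _ (⨆ o ∈ S, sourceAlg K X A o) _ _
    fun l => (comap_measurable (X c l)).mono (le_biSup (sourceAlg K X A) (hS l)) le_rfl)

lemma indepFun_phases_service (c m : ℕ) :
    IndepFun (fun ω => List.ofFn fun l => X c l ω) (A m) P := by
  have h := indep_iSup_of_disjoint hM.sourceAlg_le hM.iIndep_sourceAlg
    (S := Set.range fun l : Fin n => some (Sum.inl (c, l))) (T := {some (Sum.inr m)})
    (by simp)
  rw [IndepFun_iff_Indep]
  refine indep_of_indep_of_le_left (indep_of_indep_of_le_right h ?_) ?_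
  · exact le_biSup (sourceAlg K X A) (Set.mem_singleton (some (Sum.inr m)))
  · exact (measurable_phases_customer_iSup c fun l => Set.mem_range_self l).comap_le

lemma indep_past (m : ℕ) :
    Indep (past K X A m)
      (MeasurableSpace.comap (fun ω => (List.ofFn fun l => X (m + 1) l ω, A m ω)) inferInstance)
      P := by
  have h := indep_iSup_of_disjoint hM.sourceAlg_le hM.iIndep_sourceAlg
    (S := pastIndex n m)
    (T := insert (some (Sum.inr m)) (Set.range fun l : Fin n => some (Sum.inl (m + 1, l))))
    (by
      rw [Set.disjoint_right]
      rintro o (rfl | ⟨l, rfl⟩) ho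
      · simpa using ho _ rfl
      · simpa using ho _ rfl)
  refine indep_of_indep_of_le_right h (Measurable.comap_le ?_)
  refine @Measurable.prodMk _ _ _ _ _ (_) _ _
    (measurable_phases_customer_iSup (m + 1) fun l => Or.inr ⟨l, rfl⟩) ?_
  exact (comap_measurable (A m)).mono
    (le_biSup (sourceAlg K X A) (Set.mem_insert (some (Sum.inr m)) _)) le_rfl

variable [IsProbabilityMeasure P] [hμ : Fact (0 < μ)]

lemma map_phases_customer (c : ℕ) :
    P.map (fun ω => List.ofFn fun l => X c l ω) = phaseLaw μ n := by
  have hi : iIndepFun (fun l => X c l) P :=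
    hM.indep.precomp (g := fun l : Fin n => Sum.inl (c, l)) fun a b h => by simpa using h
  have h := (iIndepFun_iff_map_fun_eq_pi_map fun l => (hM.measurable_phase c l).aemeasurable).1 hi
  simp_rw [hM.law_phase] at h
  rw [← map_ofFn_pi_expMeasure, ← h, Measure.map_map measurable_ofFn
    (measurable_pi_lambda _ fun l => hM.measurable_phase c l)]
  rfl

lemma map_phases_service (c m : ℕ) :
    P.map (fun ω => (List.ofFn fun l => X c l ω, A m ω)) = (phaseLaw μ n).prod ν := by
  rw [(indepFun_iff_map_prod_eq_prod_map_map (hM.measurable_phases_customer c).aemeasurable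
    (hM.measurable_service m).aemeasurable).1 (hM.indepFun_phases_service c m),
    hM.map_phases_customer, hM.law_service]

lemma map_residual_zero :
    P.map (residual K X A 0) = ∑ i : Fin (n + 1), P {ω | K ω = i} • phaseLaw μ i := by
  ext S hS
  have hR := hM.measurable_residual 0
  have hx := hM.measurable_phases_customer 0
  rw [Measure.map_apply hR hS, Measure.finsetSum_apply]
  have h₁ := sum_measure_preimage_singleton (μ := P.restrict (residual K X A 0 ⁻¹' S))
    (Finset.univ : Finset (Fin (n + 1))) (f := K)
    fun i _ => hM.measurable_init (measurableSet_singleton i)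
  rw [Finset.coe_univ, Set.preimage_univ, Measure.restrict_apply_univ] at h₁
  rw [← h₁]
  refine Finset.sum_congr rfl fun i _ => ?_
  have hK : MeasurableSet (K ⁻¹' {i}) := hM.measurable_init (measurableSet_singleton i)
  have h₂ : K ⁻¹' {i} ∩ residual K X A 0 ⁻¹' S
      = K ⁻¹' {i} ∩ (fun ω => List.ofFn fun l => X 0 l ω) ⁻¹' (List.take i ⁻¹' S) := by
    ext ω
    simp only [Set.mem_inter_iff, Set.mem_preimage, Set.mem_singleton_iff, residual]
    refine and_congr_right fun h => ?_
    rw [h]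
  have h₃ : IndepFun K (fun ω => List.ofFn fun l => X 0 l ω) P :=
    hM.indep_init.comp (φ := id) 
      (ψ := fun y : ℕ × Fin n ⊕ ℕ → ℝ => List.ofFn fun l : Fin n => y (Sum.inl (0, l)))
      measurable_id (by fun_prop)
  rw [Measure.restrict_apply hK, h₂, h₃.measure_inter_preimage_eq_mul _ _
    (measurableSet_singleton i) (measurable_take i hS), Measure.smul_apply, smul_eq_mul,
    ← map_take_phaseLaw (Nat.lt_succ_iff.1 i.2), ← hM.map_phases_customer 0,
    Measure.map_apply (measurable_take i) hS, Measure.map_apply hx (measurable_take i hS)]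
  rfl

variable [IsProbabilityMeasure ν]

/-- The phases of the new customer and the next service time are independent of the residual phases
of the other customer, also on an event from the past. -/
lemma map_residual_prod (m : ℕ) {H : Set Ω} (hH : MeasurableSet[past K X A m] H) :
    (P.restrict H).map
        (fun ω => (residual K X A m ω, (List.ofFn fun l => X (m + 1) l ω, A m ω)))
      = ((P.restrict H).map (residual K X A m)).prod ((phaseLaw μ n).prod ν) := by
  have hξ : Measurable fun ω => (List.ofFn fun l => X (m + 1) l ω, A m ω) :=
    (hM.measurable_phases_customer (m + 1)).prodMk (hM.measurable_service m)
  have hR := hM.measurable_residual m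
  refine (Measure.prod_eq fun s t hs ht => ?_).symm
  rw [← hM.map_phases_service (m + 1) m, Measure.map_apply (hR.prodMk hξ) (hs.prod ht),
    Measure.map_apply hR hs, Measure.map_apply hξ ht,
    Measure.restrict_apply ((hR.prodMk hξ) (hs.prod ht)), Measure.restrict_apply (hR hs),
    Set.mk_preimage_prod, Set.inter_right_comm]
  exact (Indep_iff _ _ _).1 (hM.indep_past m) _ _
    (MeasurableSet.inter (measurable_residual_past m hs) hH) ⟨t, ht, rfl⟩

lemma map_residual_succ (m : ℕ) {H : Set Ω} (hH : MeasurableSet[past K X A m] H) :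
    (P.restrict H).map (residual K X A (m + 1))
      = (((P.restrict H).map (residual K X A m)).prod ((phaseLaw μ n).prod ν)).map
          (fun p => step p.1 p.2) := by
  have hξ : Measurable fun ω => (List.ofFn fun l => X (m + 1) l ω, A m ω) :=
    (hM.measurable_phases_customer (m + 1)).prodMk (hM.measurable_service m)
  rw [← hM.map_residual_prod m hH,
    Measure.map_map measurable_step ((hM.measurable_residual m).prodMk hξ)]
  rfl

end IsModel

end Law

/-! ### Finite Markov chains with a column bounded below -/

section FiniteChain

variable {ι : Type*} [Fintype ι] {M : ι → ι → ℝ} {δ : ℝ} {j₀ : ι}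

/-- A stochastic matrix with a column bounded below by `δ` contracts the `ℓ¹`-norm on vectors with
sum zero by the factor `1 - δ`: subtracting `δ` from that column changes nothing on such vectors. -/
lemma sum_abs_vecMul_le (hrow : ∀ i, ∑ j, M i j = 1) (hnn : ∀ i j, 0 ≤ M i j)
    (hδ : ∀ i, δ ≤ M i j₀) {v : ι → ℝ} (hv : ∑ i, v i = 0) :
    ∑ j, |∑ i, v i * M i j| ≤ (1 - δ) * ∑ i, |v i| := by
  classical
  have hM' : ∀ i j, 0 ≤ M i j - if j = j₀ then δ else 0 := by
    intro i j
    split_ifs with h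
    · subst h; linarith [hδ i]
    · simpa using hnn i j
  calc ∑ j, |∑ i, v i * M i j|
      = ∑ j, |∑ i, v i * (M i j - if j = j₀ then δ else 0)| := by
        simp_rw [mul_sub, Finset.sum_sub_distrib, ← Finset.sum_mul, hv, zero_mul, sub_zero]
    _ ≤ ∑ j, ∑ i, |v i| * (M i j - if j = j₀ then δ else 0) := by
        refine Finset.sum_le_sum fun j _ => (Finset.abs_sum_le_sum_abs _ _).trans_eq ?_
        exact Finset.sum_congr rfl fun i _ => by rw [abs_mul, abs_of_nonneg (hM' i j)]
    _ = (1 - δ) * ∑ i, |v i| := by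
        rw [Finset.sum_comm]
        simp_rw [← Finset.mul_sum, Finset.sum_sub_distrib, hrow]
        simp [← Finset.sum_mul, mul_comm]

lemma eq_zero_of_vecMul_eq_self (hrow : ∀ i, ∑ j, M i j = 1) (hnn : ∀ i j, 0 ≤ M i j)
    (hδ : ∀ i, δ ≤ M i j₀) (hδ0 : 0 < δ) {v : ι → ℝ} (hv : ∑ i, v i = 0)
    (hfix : ∀ j, v j = ∑ i, v i * M i j) : v = 0 := by
  have h := sum_abs_vecMul_le hrow hnn hδ hv
  simp_rw [← hfix] at h
  have h0 : 0 ≤ ∑ i, |v i| := Finset.sum_nonneg fun i _ => abs_nonneg _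
  have h1 : ∑ i, |v i| = 0 := by nlinarith
  ext i
  exact abs_eq_zero.1 ((Finset.sum_eq_zero_iff_of_nonneg fun i _ => abs_nonneg _).1 h1 i
    (Finset.mem_univ i))

lemma existsUnique_stationary (hrow : ∀ i, ∑ j, M i j = 1) (hnn : ∀ i j, 0 ≤ M i j)
    (hδ : ∀ i, δ ≤ M i j₀) (hδ0 : 0 < δ) :
    ∃! w : ι → ℝ, (∀ j, w j = ∑ i, w i * M i j) ∧ ∑ i, w i = 1 := by
  classical
  -- the constant vector `1` is in the kernel of `M - 1`, so there is also a left null vector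
  have hdet : (Matrix.of M - 1).det = 0 := by
    rw [← Matrix.exists_mulVec_eq_zero_iff]
    refine ⟨fun _ => 1, fun h => one_ne_zero (congrFun h j₀), ?_⟩
    ext i
    simp [Matrix.mulVec, dotProduct, Matrix.one_apply, hrow]
  obtain ⟨v, hv0, hv⟩ := Matrix.exists_vecMul_eq_zero_iff.2 hdet
  have hfix : ∀ j, v j = ∑ i, v i * M i j := by
    intro j
    have := congrFun hv j
    rw [Matrix.vecMul_sub, Matrix.vecMul_one] at this
    exact (sub_eq_zero.1 this).symm
  have hs : ∑ i, v i ≠ 0 := fun h => hv0 (eq_zero_of_vecMul_eq_self hrow hnn hδ hδ0 h hfix)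
  refine ⟨fun i => v i / ∑ i, v i, ⟨fun j => ?_, ?_⟩, ?_⟩
  · simp only
    rw [hfix j, Finset.sum_div]
    exact Finset.sum_congr rfl fun i _ => by ring
  · simp only
    rw [← Finset.sum_div, div_self hs]
  · rintro w ⟨hw, hw1⟩
    have hz : (fun j => w j - v j / ∑ i, v i) = 0 := by
      refine eq_zero_of_vecMul_eq_self hrow hnn hδ hδ0 ?_ fun j => ?_
      · rw [Finset.sum_sub_distrib, hw1, ← Finset.sum_div, div_self hs, sub_self]
      · simp only [sub_mul, Finset.sum_sub_distrib, ← hw j]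
        congr 1
        rw [hfix j, Finset.sum_div]
        exact Finset.sum_congr rfl fun i _ => by ring
    ext j
    exact sub_eq_zero.1 (congrFun hz j)

lemma tendsto_stationary (hrow : ∀ i, ∑ j, M i j = 1) (hnn : ∀ i j, 0 ≤ M i j)
    (hδ : ∀ i, δ ≤ M i j₀) (hδ0 : 0 < δ) {u : ℕ → ι → ℝ}
    (hu : ∀ m j, u (m + 1) j = ∑ i, u m i * M i j) (hu1 : ∀ m, ∑ i, u m i = 1) {w : ι → ℝ}
    (hw : ∀ j, w j = ∑ i, w i * M i j) (hw1 : ∑ i, w i = 1) (j : ι) :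
    Tendsto (fun m => u m j) atTop (𝓝 (w j)) := by
  have hδ1 : δ ≤ 1 := (hδ j₀).trans <| (hrow j₀).symm ▸
    Finset.single_le_sum (fun j _ => hnn j₀ j) (Finset.mem_univ j₀)
  have hb : ∀ m, ∑ i, |u m i - w i| ≤ (1 - δ) ^ m * ∑ i, |u 0 i - w i| := by
    intro m
    induction m with
    | zero => simp
    | succ m ih =>
      have h := sum_abs_vecMul_le hrow hnn hδ (v := fun i => u m i - w i)
        (by rw [Finset.sum_sub_distrib, hu1, hw1, sub_self])
      have hsub : ∀ j, ∑ i, (u m i - w i) * M i j = u (m + 1) j - w j := fun j => by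
        simp_rw [sub_mul, Finset.sum_sub_distrib, ← hu, ← hw]
      simp_rw [hsub] at h
      calc _ ≤ (1 - δ) * ∑ i, |u m i - w i| := h
        _ ≤ (1 - δ) * ((1 - δ) ^ m * ∑ i, |u 0 i - w i|) :=
          mul_le_mul_of_nonneg_left ih (by linarith)
        _ = _ := by ring
  rw [tendsto_iff_norm_sub_tendsto_zero]
  refine squeeze_zero (fun m => norm_nonneg _) (fun m => ?_)
    (by simpa using (tendsto_pow_atTop_nhds_zero_of_lt_one (r := 1 - δ) (by linarith)
      (by linarith)).mul_const (∑ i, |u 0 i - w i|))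
  exact (Finset.single_le_sum (f := fun i => |u m i - w i|) (fun i _ => abs_nonneg _)
    (Finset.mem_univ j)).trans (hb m)

end FiniteChain

/-! ### The law of the number of remaining phases -/

namespace IsModel

variable {Ω : Type*} [MeasurableSpace Ω] {P : Measure Ω} [IsProbabilityMeasure P] {n : ℕ}
  {K : Ω → Fin (n + 1)} {X : ℕ → Fin n → Ω → ℝ} {A : ℕ → Ω → ℝ} {μ : ℝ} {ν : Measure ℝ}
  [hμ : Fact (0 < μ)] [IsProbabilityMeasure ν] (hM : IsModel K X A P μ ν)
include hM

omit [IsProbabilityMeasure P] [IsProbabilityMeasure ν] in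
/-- The weights of a mixture that describes the residual phases on an event `H`. -/
lemma measure_inter_phases_eq {m : ℕ} {H : Set Ω} {c : Fin (n + 1) → ℝ≥0∞}
    (h : (P.restrict H).map (residual K X A m) = ∑ i : Fin (n + 1), c i • phaseLaw μ i)
    (j : Fin (n + 1)) : P (H ∩ {ω | phases K X A m ω = j}) = c j := by
  have hL : MeasurableSet {l : List ℝ | l.length = j} :=
    measurable_length (measurableSet_singleton (j : ℕ))
  have h₁ := congrArg (fun Q : Measure (List ℝ) => Q Set.univ) (restrict_length_sum (μ := μ) c j)
  simp only [← h, Measure.restrict_apply_univ, Measure.smul_apply, measure_univ, smul_eq_mul,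
    mul_one] at h₁
  rw [← h₁, Measure.map_apply (hM.measurable_residual m) hL,
    Measure.restrict_apply (hM.measurable_residual m hL), Set.inter_comm]
  rfl

/-- After each service completion, the residual phases of the other customer are independent and
exponential, given their number. -/
lemma map_residual (hn : 1 ≤ n) (hν : ν (Set.Iio 0) = 0) (m : ℕ) :
    P.map (residual K X A m)
      = ∑ i : Fin (n + 1), P {ω | phases K X A m ω = i} • phaseLaw μ i := by
  have key : ∃ c : Fin (n + 1) → ℝ≥0∞,
      P.map (residual K X A m) = ∑ i : Fin (n + 1), c i • phaseLaw μ i := by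
    induction m with
    | zero => exact ⟨_, hM.map_residual_zero⟩
    | succ m ih =>
      obtain ⟨c, hc⟩ := ih
      have h := hM.map_residual_succ m (H := Set.univ) MeasurableSet.univ
      rw [Measure.restrict_univ, hc, map_step_sum hn hν] at h
      exact ⟨_, h⟩
  obtain ⟨c, hc⟩ := key
  have h := hM.measure_inter_phases_eq (H := Set.univ) (by rwa [Measure.restrict_univ])
  simp_rw [Set.univ_inter] at h
  rw [hc]
  exact Finset.sum_congr rfl fun i _ => by rw [h i]

lemma real_phases_succ (hn : 1 ≤ n) (hν : ν (Set.Iio 0) = 0) (m : ℕ) (j : Fin (n + 1)) :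
    P.real {ω | phases K X A (m + 1) ω = j}
      = ∑ i : Fin (n + 1), P.real {ω | phases K X A m ω = i} * transProb n μ ν i j := by
  have h := hM.map_residual_succ m (H := Set.univ) MeasurableSet.univ
  rw [Measure.restrict_univ, hM.map_residual hn hν m, map_step_sum hn hν,
    ← Measure.restrict_univ (μ := P)] at h
  have h' := hM.measure_inter_phases_eq h j
  rw [Set.univ_inter] at h'
  rw [measureReal_def, h', ENNReal.toReal_sum fun i _ =>
    ENNReal.mul_ne_top (measure_ne_top _ _) ENNReal.ofReal_ne_top]
  refine Finset.sum_congr rfl fun i _ => ?_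
  rw [ENNReal.toReal_mul, ENNReal.toReal_ofReal
    (transProb_nonneg hn (Nat.lt_succ_iff.1 j.2) hν), Measure.restrict_univ, measureReal_def]

omit [IsProbabilityMeasure ν] in
lemma real_phases_zero (j : Fin (n + 1)) :
    P.real {ω | phases K X A 0 ω = j} = P.real {ω | K ω = j} := by
  have h := hM.map_residual_zero
  rw [← Measure.restrict_univ (μ := P)] at h
  have h' := hM.measure_inter_phases_eq h j
  rw [Set.univ_inter] at h'
  rw [measureReal_def, h', Measure.restrict_univ, measureReal_def]

lemma sum_real_phases (hn : 1 ≤ n) (hν : ν (Set.Iio 0) = 0) (m : ℕ) :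
    ∑ i : Fin (n + 1), P.real {ω | phases K X A m ω = i} = 1 := by
  have h := congrArg (fun Q : Measure (List ℝ) => Q Set.univ) (hM.map_residual hn hν m)
  have := Measure.isProbabilityMeasure_map (μ := P) (hM.measurable_residual m).aemeasurable
  simp only [measure_univ, Measure.finsetSum_apply, Measure.smul_apply, smul_eq_mul, mul_one] at h
  simp_rw [measureReal_def]
  rw [← ENNReal.toReal_sum fun i _ => measure_ne_top _ _, ← h, ENNReal.toReal_one]

/-! ### The Markov property -/

omit [MeasurableSpace Ω] [IsProbabilityMeasure P] hμ [IsProbabilityMeasure ν] hM in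
lemma history_succ (s : ℕ → Fin (n + 1)) (m : ℕ) :
    {ω | ∀ r ≤ m + 1, phases K X A r ω = s r}
      = {ω | ∀ r ≤ m, phases K X A r ω = s r} ∩ {ω | phases K X A (m + 1) ω = s (m + 1)} := by
  ext ω
  simp [Nat.le_succ_iff, or_imp, forall_and]

/-- Given the numbers of remaining phases up to the `m`-th service completion, the residual phases
are independent and exponential. -/
lemma map_residual_history (hn : 1 ≤ n) (hν : ν (Set.Iio 0) = 0) (s : ℕ → Fin (n + 1)) (m : ℕ) :
    (P.restrict {ω | ∀ r ≤ m, phases K X A r ω = s r}).map (residual K X A m)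
      = P {ω | ∀ r ≤ m, phases K X A r ω = s r} • phaseLaw μ (s m) := by
  have hL : ∀ m, MeasurableSet {l : List ℝ | l.length = s m} := fun m =>
    measurable_length (measurableSet_singleton (s m : ℕ))
  -- restricting a mixture to the lists of length `s m` leaves a single term of it
  have key : ∀ m H, (∃ c : Fin (n + 1) → ℝ≥0∞,
        (P.restrict H).map (residual K X A m) = ∑ i : Fin (n + 1), c i • phaseLaw μ i) →
      (P.restrict (H ∩ {ω | phases K X A m ω = s m})).map (residual K X A m)
        = P (H ∩ {ω | phases K X A m ω = s m}) • phaseLaw μ (s m) := by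
    rintro m H ⟨c, hc⟩
    rw [hM.measure_inter_phases_eq hc, ← restrict_length_sum, ← hc,
      Measure.restrict_map (hM.measurable_residual m) (hL m),
      Measure.restrict_restrict (hM.measurable_residual m (hL m)), Set.inter_comm]
    rfl
  induction m with
  | zero =>
    have h := key 0 Set.univ ⟨_, by rw [Measure.restrict_univ]; exact hM.map_residual_zero⟩
    simpa using h
  | succ m ih =>
    have h := hM.map_residual_succ m (measurableSet_history_past m fun r => s r)
    rw [ih, map_step_phaseLaw hn hν] at h
    rw [history_succ]
    exact key (m + 1) _ ⟨_, h⟩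

lemma real_history_succ (hn : 1 ≤ n) (hν : ν (Set.Iio 0) = 0) (s : ℕ → Fin (n + 1)) (m : ℕ) :
    P.real {ω | ∀ r ≤ m + 1, phases K X A r ω = s r}
      = P.real {ω | ∀ r ≤ m, phases K X A r ω = s r} * transProb n μ ν (s m) (s (m + 1)) := by
  have h := hM.map_residual_succ m (measurableSet_history_past m fun r => s r)
  rw [hM.map_residual_history hn hν, map_step_phaseLaw hn hν] at h
  rw [history_succ, measureReal_def, hM.measure_inter_phases_eq h, ENNReal.toReal_mul,
    ENNReal.toReal_ofReal (transProb_nonneg hn (Nat.lt_succ_iff.1 (s (m + 1)).2) hν),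
    measureReal_def]

/-! ### Distribution functions -/

omit [IsProbabilityMeasure ν] in
lemma real_prep_le (c : ℕ) (x : ℝ) : P.real {ω | prep X c ω ≤ x} = erlangCDF μ n x := by
  have h : {ω | prep X c ω ≤ x}
      = (fun ω => List.ofFn fun l => X c l ω) ⁻¹' {l : List ℝ | l.sum ≤ x} := by
    ext ω; simp [prep, List.sum_ofFn]
  rw [h, measureReal_def, ← Measure.map_apply (hM.measurable_phases_customer c)
    (measurableSet_le measurable_sum_list measurable_const), hM.map_phases_customer,
    measure_sum_le_phaseLaw, ENNReal.toReal_ofReal (erlangCDF_nonneg n x)]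

lemma real_remaining_le (hn : 1 ≤ n) (hν : ν (Set.Iio 0) = 0) (m : ℕ) (x : ℝ) :
    P.real {ω | remaining K X A m ω ≤ x}
      = mixedErlangCDF μ (fun i : Fin (n + 1) => P.real {ω | phases K X A m ω = i}) x := by
  have hS : MeasurableSet {l : List ℝ | l.sum ≤ x} :=
    measurableSet_le measurable_sum_list measurable_const
  have h : {ω | remaining K X A m ω ≤ x} = residual K X A m ⁻¹' {l : List ℝ | l.sum ≤ x} := rfl
  rw [h, measureReal_def, ← Measure.map_apply (hM.measurable_residual m) hS,
    hM.map_residual hn hν, Measure.finsetSum_apply, mixedErlangCDF_eq_sum]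
  simp_rw [Measure.smul_apply, measure_sum_le_phaseLaw, smul_eq_mul]
  rw [ENNReal.toReal_sum fun i _ =>
    ENNReal.mul_ne_top (measure_ne_top _ _) ENNReal.ofReal_ne_top]
  refine Finset.sum_congr rfl fun i _ => ?_
  rw [ENNReal.toReal_mul, ENNReal.toReal_ofReal (erlangCDF_nonneg _ x), measureReal_def]

omit [IsProbabilityMeasure ν] in
lemma real_waiting_le (m : ℕ) (x : ℝ) :
    P.real {ω | waiting K X A m ω ≤ x}
      = P.real {ω | remaining K X A m ω ≤ x} + erlangCDF μ n x
        - P.real {ω | remaining K X A m ω ≤ x} * erlangCDF μ n x := by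
  have hS : MeasurableSet {l : List ℝ | l.sum ≤ x} :=
    measurableSet_le measurable_sum_list measurable_const
  have hR : MeasurableSet[past K X A m] {ω | remaining K X A m ω ≤ x} :=
    measurable_residual_past m hS
  have hB : {ω | prep X (m + 1) ω ≤ x}
      = (fun ω => (List.ofFn fun l => X (m + 1) l ω, A m ω)) ⁻¹' {q | q.1.sum ≤ x} := by
    ext ω; simp [prep, List.sum_ofFn]
  have hB' : MeasurableSet {ω | prep X (m + 1) ω ≤ x} := by
    rw [hB]
    exact ((hM.measurable_phases_customer (m + 1)).prodMk (hM.measurable_service m))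
      (measurable_fst hS)
  have hunion : {ω | waiting K X A m ω ≤ x}
      = {ω | remaining K X A m ω ≤ x} ∪ {ω | prep X (m + 1) ω ≤ x} := by
    ext ω; simp [waiting, or_comm]
  have hinter : P.real ({ω | remaining K X A m ω ≤ x} ∩ {ω | prep X (m + 1) ω ≤ x})
      = P.real {ω | remaining K X A m ω ≤ x} * P.real {ω | prep X (m + 1) ω ≤ x} := by
    simp_rw [measureReal_def]
    rw [← ENNReal.toReal_mul, (Indep_iff _ _ _).1 (hM.indep_past m) _ _ hR
      ⟨{q | q.1.sum ≤ x}, measurable_fst hS, hB.symm⟩]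
  have h := measureReal_union_add_inter (μ := P) (s := {ω | remaining K X A m ω ≤ x}) hB'
  rw [hunion]
  rw [hinter, hM.real_prep_le] at h
  linarith

end IsModel

end MachineRepair

theorem theorem3 (n : ℕ) (hn : 1 ≤ n) (μ : ℝ) (hμ : 0 < μ)
    (ν : Measure ℝ) [IsProbabilityMeasure ν] (hν : ν (Set.Iio 0) = 0)
    {Ω : Type*} [MeasurableSpace Ω] (P : Measure Ω) [IsProbabilityMeasure P]
    (K : Ω → Fin (n + 1)) (X : ℕ → Fin n → Ω → ℝ) (A : ℕ → Ω → ℝ)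
    (hM : IsModel K X A P μ ν) :
    -- the series in the transition probabilities converge
    Summable (serviceTerm μ ν) ∧
    -- the number of remaining phases is a Markov chain on `{0, …, n}` with matrix `transProb`
    (∀ m ω, phases K X A m ω ≤ n) ∧
    (∀ (m : ℕ) (s : ℕ → Fin (n + 1)),
      P.real {ω | ∀ r ≤ m + 1, phases K X A r ω = s r} =
        P.real {ω | ∀ r ≤ m, phases K X A r ω = s r} * transProb n μ ν (s m) (s (m + 1))) ∧
    -- the preparation times are Erlang-`n`
    (∀ (c : ℕ) (x : ℝ), P.real {ω | prep X c ω ≤ x} = erlangCDF μ n x) ∧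
    -- the equilibrium equations have a unique solution
    (∃! w : Fin (n + 1) → ℝ, IsEquilibrium n μ ν w) ∧
    ∀ w : Fin (n + 1) → ℝ, IsEquilibrium n μ ν w →
      (∀ i, 0 ≤ w i) ∧
      -- limiting distributions, whatever the initial distribution
      (∀ i : Fin (n + 1),
        Tendsto (fun m => P.real {ω | phases K X A m ω = i}) atTop (𝓝 (w i))) ∧
      (∀ x : ℝ, Tendsto (fun m => P.real {ω | remaining K X A m ω ≤ x}) atTop
        (𝓝 (mixedErlangCDF μ w x))) ∧
      (∀ x : ℝ, Tendsto (fun m => P.real {ω | waiting K X A m ω ≤ x}) atTop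
        (𝓝 (mixedErlangCDF μ w x + erlangCDF μ n x
          - mixedErlangCDF μ w x * erlangCDF μ n x))) ∧
      -- the system in equilibrium
      ((∀ i : Fin (n + 1), P.real {ω | K ω = i} = w i) → ∀ m : ℕ,
        (∀ i : Fin (n + 1), P.real {ω | phases K X A m ω = i} = w i) ∧
        (∀ x : ℝ, P.real {ω | remaining K X A m ω ≤ x} = mixedErlangCDF μ w x) ∧
        (∀ x : ℝ, P.real {ω | waiting K X A m ω ≤ x} =
          mixedErlangCDF μ w x + erlangCDF μ n x
            - mixedErlangCDF μ w x * erlangCDF μ n x)) := by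
  have : Fact (0 < μ) := ⟨hμ⟩
  obtain ⟨δ, hδ0, hδ⟩ := exists_pos_le_transProb (μ := μ) hn hν
  have hrow := sum_transProb (μ := μ) hn hν
  have hnn : ∀ i j : Fin (n + 1), 0 ≤ transProb n μ ν i j := fun i j =>
    transProb_nonneg hn (Nat.lt_succ_iff.1 j.2) hν
  have hcol : ∀ i : Fin (n + 1), δ ≤ transProb n μ ν i (Fin.last n) := fun i =>
    hδ i (Nat.lt_succ_iff.1 i.2)
  refine ⟨summable_serviceTerm hν, phases_le, fun m s => hM.real_history_succ hn hν s m,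
    hM.real_prep_le, existsUnique_stationary hrow hnn hcol hδ0, fun w ⟨hw, hw1⟩ => ?_⟩
  have hlim : ∀ i : Fin (n + 1),
      Tendsto (fun m => P.real {ω | phases K X A m ω = i}) atTop (𝓝 (w i)) :=
    tendsto_stationary (u := fun m i => P.real {ω | phases K X A m ω = i}) hrow hnn hcol hδ0
      (fun m j => hM.real_phases_succ hn hν m j) (hM.sum_real_phases hn hν) hw hw1
  have hlimR : ∀ x : ℝ, Tendsto (fun m => P.real {ω | remaining K X A m ω ≤ x}) atTop
      (𝓝 (mixedErlangCDF μ w x)) := by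
    intro x
    simp_rw [hM.real_remaining_le hn hν, mixedErlangCDF_eq_sum]
    exact tendsto_finsetSum _ fun i _ => (hlim i).mul_const _
  refine ⟨fun i => ge_of_tendsto' (hlim i) fun m => measureReal_nonneg, hlim, hlimR, fun x => ?_,
    fun hK m => ?_⟩
  · simp_rw [hM.real_waiting_le]
    exact ((hlimR x).add_const _).sub ((hlimR x).mul_const _)
  · have hstat : ∀ i : Fin (n + 1), P.real {ω | phases K X A m ω = i} = w i := by
      induction m with
      | zero => exact fun i => (hM.real_phases_zero i).trans (hK i)
      | succ m ih =>
        intro j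
        rw [hM.real_phases_succ hn hν, hw j]
        exact Finset.sum_congr rfl fun i _ => by rw [ih i]
    have hR : ∀ x : ℝ, P.real {ω | remaining K X A m ω ≤ x} = mixedErlangCDF μ w x := by
      intro x
      rw [hM.real_remaining_le hn hν]
      simp_rw [hstat]
    exact ⟨hstat, hR, fun x => by rw [hM.real_waiting_le, hR]⟩
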